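/- Let $\mathcal S_0$ be the $(1,\infty)$-RLL constraint, i.e. the set of finite words over $\{1,2\}$ that do not contain $22$ as a contiguous subword. For $\varepsilon\in[0,1)$ consider the binary erasure channel $Y_n=X_nE_n$, where $\{E_n\}$ is i.i.d. with $P(E_n=0)=\varepsilon$, $P(E_n=1)=1-\varepsilon$, and is independent of the input $\{X_n\}$. The input is a stationary first-order Markov chain on $\{1,2\}$ supported on $\mathcal S_0$ (every word of positive probability lies in $\mathcal S_0$). Logarithms are natural, $I(X;Y)=\lim_{n\to\infty}\frac1n I(X_1^n;Y_1^n)$ is the mutual information rate, and $C^{(1)}(\mathcal S_0,\varepsilon)$ is the supremum of $I(X;Y)$ over all such inputs. For $\theta\in[0,1]$ let $X$ be the stationary chain with transition matrix $\begin{bmatrix}1-\theta&\theta\\1&0\end{bmatrix}$ and stationary law $\left(\frac1{1+\theta},\frac\theta{1+\theta}\right)$; then $I(X;Y)$ and $H_k(\theta):=H(X_0|X_{-k-1})$ ($k\ge0$) are functions of $\theta$. Let $\lambda=(1+\sqrt5)/2$. The limit defining $I(X;Y)$ exists for every such input. For every $\varepsilon\in[0,1)$ the function $\theta\mapsto I(X;Y)$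 has a unique maximizer $\theta_{\max}(\varepsilon)$ on $[0,1]$, the supremum $C^{(1)}(\mathcal S_0,\varepsilon)$ is finite and equal to the value of $I(X;Y)$ at $\theta_{\max}(\varepsilon)$, and $\theta_{\max}(0)=1/\lambda^2$. Moreover (derivatives at $\varepsilon=0$ are taken from the right): a) $\theta_{\max}$ is analytic on $[0,1)$, $H_0''(1/\lambda^2)\neq0$, and for all $n\ge1$ $$\theta_{\max}^{(n)}(0)=-\Big(H_0''\big(\tfrac1{\lambda^2}\big)\Big)^{-1}\Big\{\sum_{k=1}^{n}\binom nk k!\sum_{m_1,\dots,m_{n-k}}a(m_1,\dots,m_{n-k})\,H_k^{(m_1+\cdots+m_{n-k}+1)}\big(\tfrac1{\lambda^2}\big)\prod_{j=1}^{n-k}\big(\theta_{\max}^{(j)}(0)\big)^{m_j}$$ $$\qquad+\sum_{m_1,\dots,m_n:\ m_n=0}a(m_1,\dots,m_n)\,H_0^{(m_1+\cdots+m_n+1)}\big(\tfrac1{\lambda^2}\big)\prod_{j=1}^{n}\big(\theta_{\max}^{(j)}(0)\big)^{m_j}\Big\},$$ where the sums over $m_1,\dots,m_N$ run over all nonnegative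 integers with $m_1+2m_2+\cdots+Nm_N=N$ (for $N=0$ there is just the empty tuple), and $$a(m_1,\dots,m_N)=\frac{N!}{m_1!\,(1!)^{m_1}\cdots m_N!\,(N!)^{m_N}}.$$ b) $C^{(1)}(\mathcal S_0,\varepsilon)$ and the functions $G_k(\varepsilon):=H_k(\theta_{\max}(\varepsilon))$, $k\ge0$, are analytic in $\varepsilon$ on $[0,1)$, and for all sufficiently small $\varepsilon\ge0$ $$C^{(1)}(\mathcal S_0,\varepsilon)=\sum_{n=0}^\infty\frac1{n!}\Big(G_0^{(n)}(0)+n\,(G_1-2G_0)^{(n-1)}(0)+\sum_{k=2}^n\binom nk k!\,(G_k+G_{k-2}-2G_{k-1})^{(n-k)}(0)\Big)\varepsilon^n,$$ where the second summand is $0$ for $n=0$. -/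

import Mathlib

open Set Filter Topology
open scoped Nat

noncomputable section

namespace BEC

/-! ### Information quantities of finite distributions (natural logarithm) -/

/-- First marginal of a joint law. -/
def fstLaw {α β : Type} [Fintype β] (p : α × β → ℝ) (a : α) : ℝ := ∑ b, p (a, b)

/-- Second marginal of a joint law. -/
def sndLaw {α β : Type} [Fintype α] (p : α × β → ℝ) (b : β) : ℝ := ∑ a, p (a, b)

/-- Conditional entropy `H(B | A)` of a pair `(A, B)` with joint law `p`. -/
def condEntropy {α β : Type} [Fintype α] [Fintype β] (p : α × β → ℝ) : ℝ :=
  -∑ z, p z * Real.log (p z / fstLaw p z.1)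

/-- Mutual information `I(A; B)` of a pair `(A, B)` with joint law `p`. -/
def mutualInfo {α β : Type} [Fintype α] [Fintype β] (p : α × β → ℝ) : ℝ :=
  ∑ z, p z * Real.log (p z / (fstLaw p z.1 * sndLaw p z.2))

/-! ### Stationary first-order Markov chains on a two-letter alphabet -/

/-- The input alphabet `{1, 2}`: the index `0` is the letter `1`, the index `1` the letter `2`. -/
abbrev Letter : Type := Fin 2

/-- `π` and `P` are the initial law and the transition matrix of a stationary Markov chain. -/
structure IsStationaryChain (π : Letter → ℝ) (P : Matrix Letter Letter ℝ) : Prop where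
  init_nonneg : ∀ a, 0 ≤ π a
  init_sum : ∑ a, π a = 1
  trans_nonneg : ∀ a b, 0 ≤ P a b
  trans_sum : ∀ a, ∑ b, P a b = 1
  stationary : ∀ b, ∑ a, π a * P a b = π b

/-- The law of `n + 1` consecutive letters of the chain. -/
def blockLaw (π : Letter → ℝ) (P : Matrix Letter Letter ℝ) (n : ℕ)
    (x : Fin (n + 1) → Letter) : ℝ :=
  π (x 0) * ∏ i : Fin n, P (x i.castSucc) (x i.succ)

/-- The joint law of `(X_{-k-1}, X_0)`. -/
def pairLaw (π : Letter → ℝ) (P : Matrix Letter Letter ℝ) (k : ℕ) (z : Letter × Letter) : ℝ :=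
  ∑ x : Fin (k + 2) → Letter,
    if x 0 = z.1 ∧ x (Fin.last (k + 1)) = z.2 then blockLaw π P (k + 1) x else 0

/-- The `(1, ∞)`-RLL constraint: the words over `{1, 2}` in which `22` does not occur. -/
def rllConstraint : Set (List Letter) := {w | ¬ [1, 1] <:+: w}

/-- All words of positive probability belong to the set of words `S`. -/
def SupportedOn (S : Set (List Letter)) (π : Letter → ℝ) (P : Matrix Letter Letter ℝ) : Prop :=
  ∀ (n : ℕ) (x : Fin (n + 1) → Letter), 0 < blockLaw π P n x → List.ofFn x ∈ S

/-! ### The binary erasure channel -/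

/-- The law of one erasure variable `E`: `P(E = 0) = ε` and `P(E = 1) = 1 - ε`. -/
def erasureLaw (ε : ℝ) (e : Bool) : ℝ := if e then 1 - ε else ε

/-- The channel output: the letter itself where `E = 1`, the erasure symbol `none` where `E = 0`. -/
def channelOutput {n : ℕ} (x : Fin n → Letter) (e : Fin n → Bool) : Fin n → Option Letter :=
  fun i => if e i then some (x i) else none

/-- The joint law of input and output block, for an input block of law `q` and i.i.d. erasures
that are independent of the input. -/
def jointLaw (ε : ℝ) {n : ℕ} (q : (Fin n → Letter) → ℝ)
    (z : (Fin n → Letter) × (Fin n → Option Letter)) : ℝ :=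
  ∑ e : Fin n → Bool, if z.2 = channelOutput z.1 e then q z.1 * ∏ i, erasureLaw ε (e i) else 0

/-- The mutual information per letter of input and output blocks of length `n + 1`. -/
def blockInfo (ε : ℝ) (π : Letter → ℝ) (P : Matrix Letter Letter ℝ) (n : ℕ) : ℝ :=
  mutualInfo (jointLaw ε (blockLaw π P n)) / ((n : ℝ) + 1)

/-- The mutual information rate `I(X; Y)`. -/
def infoRate (ε : ℝ) (π : Letter → ℝ) (P : Matrix Letter Letter ℝ) : ℝ :=
  limUnder atTop (blockInfo ε π P)

/-- The mutual information rates of the stationary first-order Markov inputs supported on the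
`(1, ∞)`-RLL constraint. -/
def markovRates (ε : ℝ) : Set ℝ :=
  {r | ∃ (π : Letter → ℝ) (P : Matrix Letter Letter ℝ),
    IsStationaryChain π P ∧ SupportedOn rllConstraint π P ∧ r = infoRate ε π P}

/-- The first-order Markov capacity of the erasure channel under the `(1, ∞)`-RLL constraint. -/
def markovCapacity (ε : ℝ) : ℝ := sSup (markovRates ε)

/-! ### The one-parameter family of inputs -/

/-- The transition matrix with parameter `θ`. -/
def rllTrans (θ : ℝ) : Matrix Letter Letter ℝ := !![1 - θ, θ; 1, 0]

/-- The stationary law of `rllTrans θ`. -/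
def rllInit (θ : ℝ) : Letter → ℝ := ![1 / (1 + θ), θ / (1 + θ)]

theorem isStationaryChain_rll {θ : ℝ} (h : θ ∈ Icc (0 : ℝ) 1) :
    IsStationaryChain (rllInit θ) (rllTrans θ) := by
  obtain ⟨h0, h1⟩ := h
  have h2 : (1 + θ) ≠ 0 := by positivity
  refine ⟨?_, ?_, ?_, ?_, ?_⟩
  · intro a
    fin_cases a <;> simp [rllInit] <;> positivity
  · simp [rllInit]
    field_simp
  · intro a b
    fin_cases a <;> fin_cases b <;> simp [rllTrans, h0, h1]
  · intro a
    fin_cases a <;> simp [rllTrans]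
  · intro b
    fin_cases b <;> simp [rllTrans, rllInit] <;> field_simp
    ring

/-- `I(X; Y)` as a function of the parameter. -/
def rllRate (ε θ : ℝ) : ℝ := infoRate ε (rllInit θ) (rllTrans θ)

/-- `H(X_0 | X_{-k-1})` as a function of the parameter. -/
def rllCondEntropy (k : ℕ) (θ : ℝ) : ℝ := condEntropy (pairLaw (rllInit θ) (rllTrans θ) k)

/-- `θ` is the unique maximizer of `I(X; Y)` over `[0, 1]`. -/
def IsOptimalParam (ε θ : ℝ) : Prop :=
  θ ∈ Icc (0 : ℝ) 1 ∧ ∀ s ∈ Icc (0 : ℝ) 1, s ≠ θ → rllRate ε s < rllRate ε θ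

/-! ### The terms of the Faà di Bruno formula -/

/-- The tuples `(m₁, …, m_N)` of natural numbers with `m₁ + 2 m₂ + ⋯ + N m_N = N`;
`m i` is the entry with the number `i + 1`. -/
def bruno (N : ℕ) : Finset (Fin N → ℕ) :=
  (Fintype.piFinset fun _ => Finset.range (N + 1)).filter fun m =>
    ∑ i : Fin N, ((i : ℕ) + 1) * m i = N

/-- `N! / (m₁! 1!^{m₁} ⋯ m_N! N!^{m_N})`. -/
def brunoCoeff {N : ℕ} (m : Fin N → ℕ) : ℝ :=
  (N ! : ℝ) / (∏ i : Fin N, ((m i)! : ℝ) * (((i : ℕ) + 1)! : ℝ) ^ m i)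

/-- The summand of the Faà di Bruno formula that belongs to the tuple `m`, for the derivative of
order `N` of `F' ∘ θ` at a point that `θ` maps to `t`; `d j` is the `j`-th derivative of `θ`. -/
def brunoTerm (F : ℝ → ℝ) (t : ℝ) (d : ℕ → ℝ) {N : ℕ} (m : Fin N → ℕ) : ℝ :=
  brunoCoeff m * iteratedDeriv ((∑ i, m i) + 1) F t * (∏ i : Fin N, d ((i : ℕ) + 1) ^ m i)

/-- The derivative of order `n` at `0`, from the right, of a function on `[0, 1)`. -/
def derivAtZero (f : ℝ → ℝ) (n : ℕ) : ℝ := iteratedDerivWithin n f (Ico 0 1) 0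

/-- The function `G_k(ε) = H(X_0 | X_{-k-1})(θmax(ε))`. -/
def entropyAlong (θmax : ℝ → ℝ) (k : ℕ) (ε : ℝ) : ℝ := rllCondEntropy k (θmax ε)

/-- The derivative of order `n` of the capacity at `0` in terms of the functions `G k`. For `n = 0`
the second summand has the factor `0` and the third is an empty sum. -/
def capacityCoeff (G : ℕ → ℝ → ℝ) (n : ℕ) : ℝ :=
  derivAtZero (G 0) n
    + n * derivAtZero (fun ε => G 1 ε - 2 * G 0 ε) (n - 1)
    + ∑ k ∈ Finset.Icc 2 n, (n.choose k : ℝ) * (k ! : ℝ) *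
        derivAtZero (fun ε => G k ε + G (k - 2) ε - 2 * G (k - 1) ε) (n - k)

end BEC

end

/-! Given the output, the erasure pattern is known, so the mutual information of a block is the mean
entropy of its unerased letters. Splitting off the first letter gives a recursion for this mean,
from which $I(X;Y)=(1-\varepsilon)^2\sum_k\varepsilon^kH_k$ for every stationary chain
(`tendsto_blockInfo`): a seen letter has probability $1-\varepsilon$, and its last seen predecessor
lies $k+1$ steps back with probability $(1-\varepsilon)\varepsilon^k$. An admissible chain has the
block laws of a member of the $\theta$-family, so only the maximization over $\theta$ remains.

Each $H_k$ is concave as a function of the stationary probability $x=\theta/(1+\theta)$ of the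
letter $2$, and $H_0$ strictly so. Since $d/dx=(1+\theta)^2\,d/d\theta$, this says that `rllSlope k`
decreases. It is proved from closed forms in $\theta$ and $u=-(-\theta)^k$, with a separate sign
argument for each parity of $k$. All $H_k$ vanish at $\theta=0,1$, hence the rate has an interior
maximizer, which is its only critical point and is nondegenerate.

For analyticity, $(H_k(\theta))_k$ is treated as one analytic function of $\theta\in(0,1)$ with
values in the Banach algebra of bounded sequences (`exists_analytic_entropies`), and
$x\mapsto\sum_k\varepsilon^kx_k$ as an analytic function of $\varepsilon$ with values in its dual
(`geomEval`). Their pairing is jointly analytic, and the implicit function theorem yields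
$\theta_{\max}$, together with an analytic extension to a two-sided neighbourhood of each point
(`exists_analytic_optimalParam`).

Both formulas come from `iteratedDeriv_geomEval`, which differentiates $\sum_kt^kK_k(t)$ at $0$.
Applied to the critical equation along $\theta_{\max}$, with the formula of Faà di Bruno for each
term, it gives the recursion in a); applied to the second differences of $(G_k)$, which absorb the
factor $(1-\varepsilon)^2$, it gives the series in b). -/

noncomputable section

namespace BEC

/-! ### Mutual information across the erasure channel -/

/-- The total mass of the words that agree with `x` where `e` is true. -/
def seenMarginal {n : ℕ} (q : (Fin n → Letter) → ℝ) (e : Fin n → Bool) (x : Fin n → Letter) : ℝ :=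
  ∑ x', if ∀ i, e i = true → x' i = x i then q x' else 0

/-- The output reveals the erasure pattern, since `none` occurs exactly at the erased places. -/
lemma channelOutput_eq_iff {n : ℕ} {x x' : Fin n → Letter} {e e' : Fin n → Bool} :
    channelOutput x e = channelOutput x' e' ↔ e' = e ∧ ∀ i, e i = true → x' i = x i := by
  constructor
  · intro h
    have h' : ∀ i, channelOutput x e i = channelOutput x' e' i := fun i => congrFun h i
    simp only [channelOutput] at h'
    refine ⟨funext fun i => ?_, fun i hi => ?_⟩
    · have := h' i
      cases h1 : e i <;> cases h2 : e' i <;> simp [h1, h2] at this ⊢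
    · have := h' i
      cases h2 : e' i <;> simp [hi, h2] at this ⊢
      exact this.symm
  · rintro ⟨rfl, h⟩
    funext i
    by_cases hi : e' i = true
    · simp [channelOutput, hi, h i hi]
    · simp [channelOutput, hi]

lemma sum_prod_erasureLaw (ε : ℝ) (n : ℕ) :
    ∑ e : Fin n → Bool, ∏ i, erasureLaw ε (e i) = 1 := by
  rw [← Fintype.prod_sum]
  simp [erasureLaw]

lemma jointLaw_channelOutput (ε : ℝ) {n : ℕ} (q : (Fin n → Letter) → ℝ)
    (x : Fin n → Letter) (e : Fin n → Bool) :
    jointLaw ε q (x, channelOutput x e) = q x * ∏ i, erasureLaw ε (e i) := by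
  have : ∀ e', channelOutput x e = channelOutput x e' ↔ e' = e := fun e' => by
    rw [channelOutput_eq_iff]; simp
  simp [jointLaw, this]

lemma fstLaw_jointLaw (ε : ℝ) {n : ℕ} (q : (Fin n → Letter) → ℝ) (x : Fin n → Letter) :
    fstLaw (jointLaw ε q) x = q x := by
  simp only [fstLaw, jointLaw]
  rw [Finset.sum_comm]
  simp [← Finset.mul_sum, sum_prod_erasureLaw]

lemma sndLaw_jointLaw (ε : ℝ) {n : ℕ} (q : (Fin n → Letter) → ℝ)
    (x : Fin n → Letter) (e : Fin n → Bool) :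
    sndLaw (jointLaw ε q) (channelOutput x e) =
      seenMarginal q e x * ∏ i, erasureLaw ε (e i) := by
  simp only [sndLaw, jointLaw, seenMarginal, Finset.sum_mul]
  refine Finset.sum_congr rfl fun x' _ => ?_
  simp only [channelOutput_eq_iff, ite_and]
  simp

/-- The mutual information is the mean entropy of the letters that are not erased. -/
lemma mutualInfo_jointLaw (ε : ℝ) {n : ℕ} (q : (Fin n → Letter) → ℝ) :
    mutualInfo (jointLaw ε q) = ∑ e : Fin n → Bool, ∑ x,
      (∏ i, erasureLaw ε (e i)) * (q x * -Real.log (seenMarginal q e x)) := by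
  have key : ∀ (x : Fin n → Letter) (e : Fin n → Bool),
      q x * (∏ i, erasureLaw ε (e i)) * Real.log (jointLaw ε q (x, channelOutput x e) /
        (fstLaw (jointLaw ε q) x * sndLaw (jointLaw ε q) (channelOutput x e))) =
      (∏ i, erasureLaw ε (e i)) * (q x * -Real.log (seenMarginal q e x)) := by
    intro x e
    rw [jointLaw_channelOutput, fstLaw_jointLaw, sndLaw_jointLaw]
    set w := ∏ i, erasureLaw ε (e i)
    by_cases hq : q x = 0
    · simp [hq]
    by_cases hw : w = 0
    · simp [hw]
    have : q x * w / (q x * (seenMarginal q e x * w)) = (seenMarginal q e x)⁻¹ := by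
      rw [← mul_assoc, mul_right_comm]
      by_cases hm : seenMarginal q e x = 0
      · simp [hm]
      · field_simp
    rw [this, Real.log_inv]
    ring
  simp_rw [← key]
  rw [mutualInfo, Fintype.sum_prod_type, Finset.sum_comm (s := Finset.univ (α := Fin n → Bool))]
  refine Finset.sum_congr rfl fun x _ => ?_
  -- For fixed `x` the joint law sits on the outputs of `x`, one for each pattern, so the sum over
  -- outputs becomes a sum over patterns.
  have : ∀ g : (Fin n → Option Letter) → ℝ, ∑ y, jointLaw ε q (x, y) * g y =
      ∑ e : Fin n → Bool, q x * (∏ i, erasureLaw ε (e i)) * g (channelOutput x e) := by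
    intro g
    simp only [jointLaw, Finset.sum_mul]
    rw [Finset.sum_comm]
    simp
  exact this fun y => Real.log (jointLaw ε q (x, y) /
    (fstLaw (jointLaw ε q) x * sndLaw (jointLaw ε q) y))

/-! ### Markov words -/

/-- `v` is a probability vector. -/
def IsLaw (v : Letter → ℝ) : Prop := (∀ a, 0 ≤ v a) ∧ ∑ a, v a = 1

/-- The law of the word of `N` letters whose first letter has the law `v`. -/
def wordLaw (P : Matrix Letter Letter ℝ) : (N : ℕ) → (Letter → ℝ) → (Fin N → Letter) → ℝ
  | 0, _, _ => 1
  | N + 1, v, x => v (x 0) * wordLaw P N (P (x 0)) (Fin.tail x)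

/-- The law of the letters of a word that are not erased. -/
def seenLaw (P : Matrix Letter Letter ℝ) :
    (N : ℕ) → (Letter → ℝ) → (Fin N → Bool) → (Fin N → Letter) → ℝ
  | 0, _, _, _ => 1
  | N + 1, v, e, x =>
    if e 0 then v (x 0) * seenLaw P N (P (x 0)) (Fin.tail e) (Fin.tail x)
    else seenLaw P N (Matrix.vecMul v P) (Fin.tail e) (Fin.tail x)

/-- The mean entropy of the letters of a word that are not erased. -/
def seenEntropy (P : Matrix Letter Letter ℝ) (ε : ℝ) (N : ℕ) (v : Letter → ℝ) : ℝ :=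
  ∑ e : Fin N → Bool, ∑ x, (∏ i, erasureLaw ε (e i)) *
    (wordLaw P N v x * -Real.log (seenLaw P N v e x))

/-- The entropy of a vector. -/
def vecEntropy (v : Letter → ℝ) : ℝ := ∑ a, Real.negMulLog (v a)

lemma sum_fin_succ_arrow {α : Type} [Fintype α] {N : ℕ} (f : (Fin (N + 1) → α) → ℝ) :
    ∑ x, f x = ∑ a, ∑ y : Fin N → α, f (Fin.cons a y) := by
  rw [← (Fin.consEquiv fun _ => α).sum_comp, Fintype.sum_prod_type]
  rfl

variable {P : Matrix Letter Letter ℝ}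

lemma IsLaw.vecMul {v : Letter → ℝ} (hv : IsLaw v) (hP : ∀ a, IsLaw (P a)) :
    IsLaw (Matrix.vecMul v P) := by
  refine ⟨fun b => ?_, ?_⟩
  · simp only [Matrix.vecMul, dotProduct]
    exact Finset.sum_nonneg fun a _ => mul_nonneg (hv.1 a) ((hP a).1 b)
  · simp only [Matrix.vecMul, dotProduct]
    rw [Finset.sum_comm]
    simp_rw [← Finset.mul_sum, fun a => (hP a).2, mul_one]
    exact hv.2

lemma wordLaw_nonneg (hP : ∀ a, IsLaw (P a)) : ∀ {N : ℕ} {v : Letter → ℝ} (_ : IsLaw v)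
    (x : Fin N → Letter), 0 ≤ wordLaw P N v x
  | 0, _, _, _ => zero_le_one
  | _ + 1, _, hv, _ => mul_nonneg (hv.1 _) (wordLaw_nonneg hP (hP _) _)

lemma sum_wordLaw (hP : ∀ a, IsLaw (P a)) : ∀ {N : ℕ} {v : Letter → ℝ} (_ : IsLaw v),
    ∑ x, wordLaw P N v x = 1
  | 0, _, _ => by simp [wordLaw]
  | N + 1, v, hv => by
    rw [sum_fin_succ_arrow]
    simp only [wordLaw, Fin.cons_zero, Fin.tail_cons, ← Finset.mul_sum]
    simp_rw [fun a => sum_wordLaw hP (N := N) (hP a), mul_one]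
    exact hv.2

lemma sum_mul_wordLaw (N : ℕ) {v : Letter → ℝ} (hv : IsLaw v) (y : Fin N → Letter) :
    ∑ a, v a * wordLaw P N (P a) y = wordLaw P N (Matrix.vecMul v P) y := by
  cases N with
  | zero => simpa [wordLaw] using hv.2
  | succ N => simp only [wordLaw, ← mul_assoc, ← Finset.sum_mul, Matrix.vecMul, dotProduct]

/-- Induction on the length: a seen first letter fixes the first summation index, and summing out an
erased one turns the law `v` of the first letter into `Matrix.vecMul v P`. -/
lemma seenLaw_eq_seenMarginal (hP : ∀ a, IsLaw (P a)) : ∀ {N : ℕ} {v : Letter → ℝ} (_ : IsLaw v)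
    (e : Fin N → Bool) (x : Fin N → Letter),
    seenMarginal (wordLaw P N v) e x = seenLaw P N v e x
  | 0, _, _, _, _ => by simp [seenMarginal, wordLaw, seenLaw]
  | N + 1, v, hv, e, x => by
    rw [seenMarginal, sum_fin_succ_arrow, seenLaw]
    simp only [Fin.forall_fin_succ, Fin.cons_zero, Fin.cons_succ, wordLaw, Fin.tail_cons]
    cases h : e 0 with
    | true =>
      simp only [forall_const, ite_and, if_true]
      rw [← seenLaw_eq_seenMarginal hP (hP _), seenMarginal, Finset.mul_sum,
        Finset.sum_eq_single (x 0) (fun b _ hb => by simp [hb]) (by simp)]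
      refine Finset.sum_congr rfl fun y _ => ?_
      have hxe : (∀ i : Fin N, Fin.tail e i = true → y i = Fin.tail x i) ↔
          ∀ i : Fin N, e i.succ = true → y i = x i.succ := Iff.rfl
      by_cases hy : ∀ i : Fin N, e i.succ = true → y i = x i.succ
      · rw [if_pos (hxe.2 hy)]
        simpa using fun i h1 h2 => absurd (hy i h1) h2
      · rw [if_neg (hxe.not.2 hy)]
        simp [hy]
    | false =>
      rw [if_neg (by simp), ← seenLaw_eq_seenMarginal hP (hv.vecMul hP), seenMarginal,
        Finset.sum_comm]
      refine Finset.sum_congr rfl fun y _ => ?_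
      rw [← sum_mul_wordLaw N hv]
      by_cases hy : ∀ i : Fin N, e i.succ = true → y i = x i.succ <;> simp [hy, Fin.tail]

lemma wordLaw_le_seenLaw (hP : ∀ a, IsLaw (P a)) {N : ℕ} {v : Letter → ℝ} (hv : IsLaw v)
    (e : Fin N → Bool) (x : Fin N → Letter) : wordLaw P N v x ≤ seenLaw P N v e x := by
  rw [← seenLaw_eq_seenMarginal hP hv, seenMarginal]
  refine le_trans (by simp) (Finset.single_le_sum (f := fun x' =>
    if ∀ i, e i = true → x' i = x i then wordLaw P N v x' else 0) (fun x' _ => ?_)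
    (Finset.mem_univ x))
  split_ifs
  · exact wordLaw_nonneg hP hv _
  · exact le_rfl

lemma seenEntropy_zero (ε : ℝ) (v : Letter → ℝ) : seenEntropy P ε 0 v = 0 := by
  simp [seenEntropy, seenLaw]

/-- Chain rule for the first letter. If it is seen, it contributes its own entropy and the rest
restarts from the row `P a`; if it is erased, the rest starts from the law moved by one step. -/
lemma seenEntropy_succ (hP : ∀ a, IsLaw (P a)) (ε : ℝ) (N : ℕ) {v : Letter → ℝ} (hv : IsLaw v) :
    seenEntropy P ε (N + 1) v =
      (1 - ε) * (vecEntropy v + ∑ a, v a * seenEntropy P ε N (P a)) +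
        ε * seenEntropy P ε N (Matrix.vecMul v P) := by
  rw [seenEntropy, sum_fin_succ_arrow, Fintype.sum_bool]
  simp only [sum_fin_succ_arrow, Fin.prod_univ_succ, Fin.cons_zero, Fin.cons_succ, seenLaw,
    wordLaw, Fin.tail_cons, erasureLaw, if_true, Bool.false_eq_true, if_false]
  congr 1
  · have key : ∀ (e : Fin N → Bool) (a : Letter) (y : Fin N → Letter),
        v a * wordLaw P N (P a) y * -Real.log (v a * seenLaw P N (P a) e y) =
          wordLaw P N (P a) y * Real.negMulLog (v a) +
            v a * (wordLaw P N (P a) y * -Real.log (seenLaw P N (P a) e y)) := by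
      intro e a y
      by_cases h1 : v a = 0
      · simp [h1]
      by_cases h2 : wordLaw P N (P a) y = 0
      · simp [h2]
      -- The logarithm of the product may be split only because a word of positive probability has
      -- positive seen probability.
      have h3 : seenLaw P N (P a) e y ≠ 0 :=
        (((wordLaw_nonneg hP (hP a) y).lt_of_ne' h2).trans_le
          (wordLaw_le_seenLaw hP (hP a) e y)).ne'
      rw [Real.log_mul h1 h3, Real.negMulLog]
      ring
    simp_rw [key, mul_assoc (1 - ε), ← Finset.mul_sum]
    congr 1
    simp_rw [Finset.sum_add_distrib, ← Finset.sum_mul, fun a => sum_wordLaw (N := N) hP (hP a),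
      mul_add, Finset.sum_add_distrib, ← Finset.sum_mul]
    congr 1
    · have := sum_prod_erasureLaw ε N
      simp only [erasureLaw] at this
      rw [this, vecEntropy]
      simp
    · simp_rw [Finset.mul_sum, seenEntropy, Finset.mul_sum]
      rw [Finset.sum_comm]
      refine Finset.sum_congr rfl fun a _ => Finset.sum_congr rfl fun e _ =>
        Finset.sum_congr rfl fun y _ => ?_
      simp only [erasureLaw]
      ring
  · simp_rw [seenEntropy, Finset.mul_sum]
    refine Finset.sum_congr rfl fun e _ => ?_
    rw [Finset.sum_comm]
    refine Finset.sum_congr rfl fun y _ => ?_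
    rw [← sum_mul_wordLaw N hv, Finset.sum_mul, Finset.mul_sum, Finset.mul_sum]
    refine Finset.sum_congr rfl fun a _ => ?_
    simp only [erasureLaw]
    ring

lemma blockLaw_eq_wordLaw (π : Letter → ℝ) (P : Matrix Letter Letter ℝ) :
    ∀ (n : ℕ), blockLaw π P n = wordLaw P (n + 1) π := by
  intro n
  induction n generalizing π with
  | zero => funext x; simp [blockLaw, wordLaw]
  | succ n ih =>
    funext x
    rw [wordLaw, ← ih, blockLaw, blockLaw, Fin.prod_univ_succ]
    simp only [Fin.tail]
    rfl

end BEC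

end

noncomputable section

namespace BEC

/-! ### The mutual information rate -/

variable {P : Matrix Letter Letter ℝ} {π : Letter → ℝ}

lemma IsStationaryChain.isLaw_init (h : IsStationaryChain π P) : IsLaw π :=
  ⟨h.init_nonneg, h.init_sum⟩

lemma IsStationaryChain.isLaw_trans (h : IsStationaryChain π P) (a : Letter) : IsLaw (P a) :=
  ⟨h.trans_nonneg a, h.trans_sum a⟩

lemma IsStationaryChain.vecMul_eq (h : IsStationaryChain π P) : Matrix.vecMul π P = π :=
  funext h.stationary

lemma isLaw_pow (hP : ∀ a, IsLaw (P a)) (k : ℕ) (a : Letter) : IsLaw ((P ^ (k + 1)) a) := by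
  induction k generalizing a with
  | zero => simpa using hP a
  | succ k ih =>
    rw [pow_succ (n := k + 1)]
    exact (ih a).vecMul hP

/-- The mean entropy of the letter after `k + 1` steps, given the present letter. -/
def stepEntropy (π : Letter → ℝ) (P : Matrix Letter Letter ℝ) (k : ℕ) : ℝ :=
  ∑ a, π a * vecEntropy ((P ^ (k + 1)) a)

lemma sum_mul_mul_pow (h : IsStationaryChain π P) (k : ℕ) (f : Letter → ℝ) :
    ∑ a, π a * ∑ b, (P ^ k) a b * f b = ∑ b, π b * f b := by
  have hk : Matrix.vecMul π (P ^ k) = π := by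
    induction k with
    | zero => simp
    | succ k ih => rw [pow_succ, ← Matrix.vecMul_vecMul, ih, h.vecMul_eq]
  simp_rw [Finset.mul_sum]
  rw [Finset.sum_comm]
  refine Finset.sum_congr rfl fun b _ => ?_
  conv_rhs => rw [← hk]
  simp only [Matrix.vecMul, dotProduct, Finset.sum_mul, mul_assoc]

lemma vecEntropy_nonneg {v : Letter → ℝ} (hv : IsLaw v) : 0 ≤ vecEntropy v :=
  Finset.sum_nonneg fun a _ => Real.negMulLog_nonneg (hv.1 a) <| by
    rw [← hv.2]
    exact Finset.single_le_sum (fun b _ => hv.1 b) (Finset.mem_univ a)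

/-- From $-\log x\le 1/x-1$ the entropy of two letters is at most $2-1$. The bound is not sharp;
only its uniformity matters. -/
lemma vecEntropy_le {v : Letter → ℝ} (hv : IsLaw v) : vecEntropy v ≤ 1 := by
  have : vecEntropy v ≤ ∑ a, (1 - v a) := by
    refine Finset.sum_le_sum fun a _ => ?_
    rcases (hv.1 a).eq_or_lt with h | h
    · simp [← h]
    · have h1 := Real.one_sub_inv_le_log_of_pos h
      have h2 := mul_le_mul_of_nonneg_left h1 h.le
      rw [mul_sub, mul_inv_cancel₀ h.ne'] at h2
      rw [Real.negMulLog]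
      linarith
  refine this.trans ?_
  rw [Finset.sum_sub_distrib, hv.2]
  norm_num

lemma stepEntropy_nonneg (h : IsStationaryChain π P) (k : ℕ) : 0 ≤ stepEntropy π P k :=
  Finset.sum_nonneg fun a _ =>
    mul_nonneg (h.init_nonneg a) (vecEntropy_nonneg (isLaw_pow h.isLaw_trans k a))

lemma stepEntropy_le (h : IsStationaryChain π P) (k : ℕ) : stepEntropy π P k ≤ 1 := by
  rw [← h.init_sum]
  exact Finset.sum_le_sum fun a _ =>
    mul_le_of_le_one_right (h.init_nonneg a) (vecEntropy_le (isLaw_pow h.isLaw_trans k a))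

lemma summable_stepEntropy (h : IsStationaryChain π P) {ε : ℝ} (hε : ε ∈ Ico (0 : ℝ) 1) :
    Summable fun k => ε ^ k * stepEntropy π P k :=
  Summable.of_nonneg_of_le (fun k => mul_nonneg (pow_nonneg hε.1 k) (stepEntropy_nonneg h k))
    (fun k => mul_le_of_le_one_right (pow_nonneg hε.1 k) (stepEntropy_le h k))
    (summable_geometric_of_lt_one hε.1 hε.2)

lemma tendsto_div_of_sub_tendsto {f : ℕ → ℝ} {l : ℝ}
    (h : Tendsto (fun n => f (n + 1) - f n) atTop (𝓝 l)) :
    Tendsto (fun n => f n / n) atTop (𝓝 l) := by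
  have h1 := h.cesaro
  simp only [Finset.sum_range_sub] at h1
  have h2 : Tendsto (fun n : ℕ => (n : ℝ)⁻¹ * f 0) atTop (𝓝 0) := by
    simpa using tendsto_inv_atTop_nhds_zero_nat.mul_const (f 0)
  simpa using (h1.add h2).congr fun n => by ring

/-- A contraction with bounded perturbation keeps `d` bounded. -/
lemma tendsto_div_of_contraction {d e : ℕ → ℝ} {ε K : ℝ} (hε : ε ∈ Ico (0 : ℝ) 1)
    (hd : ∀ n, d (n + 1) = ε * d n + e n) (he : ∀ n, |e n| ≤ K) :
    Tendsto (fun n => d n / n) atTop (𝓝 0) := by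
  have h1 : 0 < 1 - ε := sub_pos.2 hε.2
  have hK : 0 ≤ K := (abs_nonneg _).trans (he 0)
  have hM : ∀ n, |d n| ≤ K / (1 - ε) + |d 0| := by
    intro n
    induction n with
    | zero => linarith [div_nonneg hK h1.le]
    | succ n ih =>
      rw [hd]
      have h2 := abs_add_le (ε * d n) (e n)
      rw [abs_mul, abs_of_nonneg hε.1] at h2
      have h3 := mul_le_mul_of_nonneg_left ih hε.1
      -- $K/(1-\varepsilon)$ is the fixed point of $x\mapsto\varepsilon x+K$.
      have h4 : ε * (K / (1 - ε)) + K = K / (1 - ε) := by field_simp; ring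
      have h5 := mul_le_of_le_one_left (abs_nonneg (d 0)) hε.2.le
      linarith [he n]
  refine squeeze_zero_norm (fun n => ?_)
    (tendsto_const_div_atTop_nhds_zero_nat (K / (1 - ε) + |d 0|))
  rw [Real.norm_eq_abs, abs_div, Nat.abs_cast]
  exact div_le_div_of_nonneg_right (hM n) n.cast_nonneg

/-- The index `i` counts the erasures before the first seen letter. The start after `j + 1` steps is
kept general because an erasure raises `j` by one in the induction. -/
lemma seenEntropy_average (h : IsStationaryChain π P) (ε : ℝ) (j N : ℕ) :
    ∑ a, π a * seenEntropy P ε N ((P ^ (j + 1)) a) =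
      (1 - ε) * ∑ i ∈ Finset.range N, ε ^ i * (stepEntropy π P (j + i) +
        ∑ a, π a * seenEntropy P ε (N - 1 - i) (P a)) := by
  induction N generalizing j with
  | zero => simp [seenEntropy_zero]
  | succ N ih =>
    have h2 : ∀ i ∈ Finset.range N, ε ^ (i + 1) * (stepEntropy π P (j + (i + 1)) +
        ∑ a, π a * seenEntropy P ε (N + 1 - 1 - (i + 1)) (P a)) =
        ε * (ε ^ i * (stepEntropy π P (j + 1 + i) +
          ∑ a, π a * seenEntropy P ε (N - 1 - i) (P a))) := fun i _ => by
      rw [show N + 1 - 1 - (i + 1) = N - 1 - i by omega, show j + (i + 1) = j + 1 + i by omega,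
        pow_succ]
      ring
    rw [Finset.sum_range_succ', Finset.sum_congr rfl h2, ← Finset.mul_sum, mul_add,
      mul_left_comm, ← ih (j + 1)]
    simp_rw [fun a => seenEntropy_succ h.isLaw_trans ε N (isLaw_pow h.isLaw_trans j a)]
    have h1 : ∀ a, Matrix.vecMul ((P ^ (j + 1)) a) P = (P ^ (j + 1 + 1)) a := fun a => by
      rw [pow_succ (n := j + 1)]; rfl
    simp_rw [h1, mul_add, Finset.sum_add_distrib, mul_left_comm (π _), ← Finset.mul_sum]
    rw [sum_mul_mul_pow h]
    simp only [stepEntropy, pow_zero, Nat.add_zero, Nat.sub_zero, Nat.add_sub_cancel]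
    ring

/-- In the identity for `N + 1` minus `ε` times that for `N`, all of the convolution cancels except
its term `i = 0`. -/
lemma seenEntropy_average_sub (h : IsStationaryChain π P) (ε : ℝ) (N : ℕ) :
    ∑ a, π a * seenEntropy P ε (N + 1) (P a) - ∑ a, π a * seenEntropy P ε N (P a) =
      (1 - ε) * (∑ i ∈ Finset.range (N + 1), ε ^ i * stepEntropy π P i -
        ε * ∑ i ∈ Finset.range N, ε ^ i * stepEntropy π P i) := by
  have key := fun N => seenEntropy_average h ε 0 N
  simp only [zero_add, pow_one, mul_add, Finset.sum_add_distrib] at key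
  have h2 : ∑ i ∈ Finset.range (N + 1), ε ^ i * ∑ a, π a * seenEntropy P ε (N + 1 - 1 - i) (P a) =
      ε * ∑ i ∈ Finset.range N, ε ^ i * ∑ a, π a * seenEntropy P ε (N - 1 - i) (P a) +
        ∑ a, π a * seenEntropy P ε N (P a) := by
    rw [Finset.sum_range_succ', Finset.mul_sum _ _ ε]
    congr 1
    · refine Finset.sum_congr rfl fun i _ => ?_
      rw [show N + 1 - 1 - (i + 1) = N - 1 - i by omega, pow_succ]
      ring
    · simp
  rw [key (N + 1), h2]
  linear_combination -ε * key N

/-- The mutual information rate of a stationary chain as a power series in the erasure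
probability. -/
theorem tendsto_blockInfo (h : IsStationaryChain π P) {ε : ℝ} (hε : ε ∈ Ico (0 : ℝ) 1) :
    Tendsto (blockInfo ε π P) atTop
      (𝓝 ((1 - ε) ^ 2 * ∑' k, ε ^ k * stepEntropy π P k)) := by
  have hP := h.isLaw_trans
  set α : ℕ → ℝ := fun N => ∑ a, π a * seenEntropy P ε N (P a) with hα
  set γ : ℕ → ℝ := fun N => seenEntropy P ε N π with hγ
  have hs := (summable_stepEntropy h hε).hasSum.tendsto_sum_nat
  have hD : Tendsto (fun N => α (N + 1) - α N) atTop
      (𝓝 ((1 - ε) ^ 2 * ∑' k, ε ^ k * stepEntropy π P k)) := by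
    simp only [hα, seenEntropy_average_sub h]
    have := (((tendsto_add_atTop_iff_nat 1).2 hs).sub (hs.const_mul ε)).const_mul (1 - ε)
    refine this.trans (le_of_eq ?_)
    congr 1
    ring
  -- The increments of `α` converge, hence are bounded, and serve as the perturbation in the
  -- recursion for `γ - α`. So `γ` and `α` have the same growth rate.
  obtain ⟨K, hK⟩ := (Metric.isBounded_range_of_tendsto _ hD).exists_norm_le
  have hrec : ∀ N, γ (N + 1) - α (N + 1) = ε * (γ N - α N) +
      ((1 - ε) * vecEntropy π - (α (N + 1) - α N)) := by
    intro N
    simp only [hγ]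
    rw [seenEntropy_succ hP ε N h.isLaw_init, h.vecMul_eq]
    simp only [hα]
    ring
  have h0 := tendsto_div_of_contraction (d := fun N => γ N - α N) hε hrec
    (K := |(1 - ε) * vecEntropy π| + K) fun N => (abs_sub _ _).trans <|
      add_le_add_right (hK _ ⟨N, rfl⟩) _
  have h1 : Tendsto (fun N : ℕ => γ N / N) atTop
      (𝓝 ((1 - ε) ^ 2 * ∑' k, ε ^ k * stepEntropy π P k)) := by
    simpa using (h0.add (tendsto_div_of_sub_tendsto hD)).congr fun N => by ring
  refine ((tendsto_add_atTop_iff_nat 1).2 h1).congr fun n => ?_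
  rw [blockInfo, mutualInfo_jointLaw, blockLaw_eq_wordLaw]
  simp only [hγ, seenEntropy, seenLaw_eq_seenMarginal hP h.isLaw_init, Nat.cast_add, Nat.cast_one]

lemma infoRate_eq (h : IsStationaryChain π P) {ε : ℝ} (hε : ε ∈ Ico (0 : ℝ) 1) :
    infoRate ε π P = (1 - ε) ^ 2 * ∑' k, ε ^ k * stepEntropy π P k :=
  (tendsto_blockInfo h hε).limUnder_eq

/-! ### Two letters at a distance -/

lemma sum_wordLaw_first_last (a b : Letter) (n : ℕ) (v : Letter → ℝ) :
    (∑ x : Fin (n + 2) → Letter, if x 0 = a ∧ x (Fin.last (n + 1)) = b then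
      wordLaw P (n + 2) v x else 0) = v a * (P ^ (n + 1)) a b := by
  induction n generalizing v a with
  | zero =>
    simp only [sum_fin_succ_arrow, wordLaw, ite_and]
    simp [Fin.last, Fin.tail]
  | succ n ih =>
    rw [sum_fin_succ_arrow, pow_succ', Matrix.mul_apply]
    simp_rw [← ih]
    rw [Finset.sum_eq_single a (fun c _ hc => by simp [hc]) (by simp), Finset.sum_comm,
      Finset.mul_sum]
    refine Finset.sum_congr rfl fun y _ => ?_
    rw [wordLaw]
    simp only [Fin.cons_zero, Fin.tail_cons, true_and, ite_and, ← Fin.succ_last, Fin.cons_succ]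
    simp

lemma pairLaw_eq (k : ℕ) (z : Letter × Letter) :
    pairLaw π P k z = π z.1 * (P ^ (k + 1)) z.1 z.2 := by
  rw [pairLaw, blockLaw_eq_wordLaw, sum_wordLaw_first_last]

lemma condEntropy_pairLaw (h : IsStationaryChain π P) (k : ℕ) :
    condEntropy (pairLaw π P k) = stepEntropy π P k := by
  have h1 : ∀ a, fstLaw (pairLaw π P k) a = π a := fun a => by
    simp only [fstLaw, pairLaw_eq, ← Finset.mul_sum, (isLaw_pow h.isLaw_trans k a).2, mul_one]
  simp only [condEntropy, stepEntropy, vecEntropy, h1, pairLaw_eq]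
  rw [Fintype.sum_prod_type, ← Finset.sum_neg_distrib]
  refine Finset.sum_congr rfl fun a _ => ?_
  rw [← Finset.sum_neg_distrib, Finset.mul_sum]
  refine Finset.sum_congr rfl fun b _ => ?_
  by_cases ha : π a = 0
  · simp [ha]
  · rw [mul_div_cancel_left₀ _ ha, Real.negMulLog]
    ring

end BEC

end

noncomputable section

namespace BEC

/-! ### The chains supported on the constraint -/

/-- The chain never leaves the letter with index `0`, so row `1` of the matrix plays no role. -/
lemma wordLaw_congr_of_absorbing {P P' : Matrix Letter Letter ℝ} (h0 : P 0 = P' 0)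
    (h01 : P 0 1 = 0) : ∀ (N : ℕ) {v : Letter → ℝ} (_ : v 1 = 0), wordLaw P N v = wordLaw P' N v
  | 0, _, _ => rfl
  | N + 1, v, hv => by
    funext x
    rw [wordLaw, wordLaw]
    rcases Fin.exists_fin_two.1 ⟨x 0, rfl⟩ with h | h
    · rw [h, ← h0, wordLaw_congr_of_absorbing h0 h01 N h01]
    · rw [h, hv, zero_mul, zero_mul]

/-- Every admissible chain has the finite-dimensional laws of a chain of the one-parameter
family. -/
lemma exists_blockLaw_eq_rll {π : Letter → ℝ} {P : Matrix Letter Letter ℝ}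
    (h : IsStationaryChain π P) (hs : SupportedOn rllConstraint π P) :
    ∃ θ ∈ Icc (0 : ℝ) 1, ∀ n, blockLaw π P n = blockLaw (rllInit θ) (rllTrans θ) n := by
  have h11 : π 1 * P 1 1 = 0 := by
    by_contra hne
    have hpos : 0 < blockLaw π P 1 ![1, 1] := by
      have := (mul_nonneg (h.init_nonneg 1) (h.trans_nonneg 1 1)).lt_of_ne' hne
      simpa [blockLaw] using this
    have := hs 1 ![1, 1] hpos
    simp [rllConstraint, List.ofFn_succ] at this
  have hπ := h.init_sum
  have hr0 := h.trans_sum 0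
  have hr1 := h.trans_sum 1
  have hst := h.stationary 1
  rw [Fin.sum_univ_two] at hπ hr0 hr1 hst
  rcases mul_eq_zero.1 h11 with h1 | h1
  · have hπ0 : π 0 = 1 := by linarith
    have hP01 : P 0 1 = 0 := by rw [h1, hπ0] at hst; linarith
    -- Here the chain is constant and row `1` of `P` is undetermined. This is why the lemma compares
    -- block laws and not matrices.
    refine ⟨0, by simp, fun n => ?_⟩
    have hπ' : π = rllInit 0 := by
      funext a
      fin_cases a <;> simp [rllInit, hπ0, h1]
    rw [blockLaw_eq_wordLaw, blockLaw_eq_wordLaw, ← hπ']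
    refine wordLaw_congr_of_absorbing ?_ hP01 _ h1
    funext b
    fin_cases b
    · simp [rllTrans]; linarith
    · simp [rllTrans, hP01]
  · have hθ0 := h.trans_nonneg 0 1
    have hθ1 : P 0 1 ≤ 1 := by linarith [h.trans_nonneg 0 0]
    refine ⟨P 0 1, ⟨hθ0, hθ1⟩, fun n => ?_⟩
    have hP : P = rllTrans (P 0 1) := by
      ext a b
      fin_cases a <;> fin_cases b <;> simp [rllTrans] <;> linarith
    have hne : 1 + P 0 1 ≠ 0 := by positivity
    have hπ0 : π 0 = 1 / (1 + P 0 1) := by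
      rw [eq_div_iff hne]
      rw [h1] at hst
      linarith
    have hπ' : π = rllInit (P 0 1) := by
      funext a
      fin_cases a
      · simpa [rllInit] using hπ0
      · have : π 1 = P 0 1 / (1 + P 0 1) := by
          rw [h1] at hst
          rw [← hst, hπ0]
          ring
        simpa [rllInit] using this
    rw [← hP, ← hπ']

lemma supportedOn_rll {θ : ℝ} : SupportedOn rllConstraint (rllInit θ) (rllTrans θ) := by
  intro n x hx hmem
  obtain ⟨s, t, hst⟩ := hmem
  have hlen := congrArg List.length hst
  simp only [List.length_append, List.length_cons, List.length_nil, List.length_ofFn] at hlen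
  have hi : s.length < n := by omega
  have e1 : x (Fin.castSucc ⟨s.length, hi⟩) = 1 := by
    have h1 := congrArg (fun l => l[s.length]?) hst
    simp only [List.append_assoc, List.getElem?_append_right le_rfl, Nat.sub_self,
      List.cons_append, List.getElem?_cons_zero, List.getElem?_ofFn] at h1
    rw [dif_pos (by omega)] at h1
    exact (Option.some.inj h1).symm
  have e2 : x (Fin.succ ⟨s.length, hi⟩) = 1 := by
    have h1 := congrArg (fun l => l[s.length + 1]?) hst
    simp only [List.append_assoc, List.getElem?_append_right (Nat.le_add_right s.length 1),
      Nat.add_sub_cancel_left, List.cons_append, List.getElem?_cons_succ,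
      List.getElem?_cons_zero, List.getElem?_ofFn] at h1
    rw [dif_pos (by omega)] at h1
    exact (Option.some.inj h1).symm
  rw [blockLaw, Finset.prod_eq_zero (Finset.mem_univ ⟨s.length, hi⟩)
    (by rw [e1, e2]; simp [rllTrans]), mul_zero] at hx
  exact hx.false

lemma rllRate_eq {ε θ : ℝ} (hε : ε ∈ Ico (0 : ℝ) 1) (hθ : θ ∈ Icc (0 : ℝ) 1) :
    rllRate ε θ = (1 - ε) ^ 2 * ∑' k, ε ^ k * rllCondEntropy k θ := by
  simp only [rllRate, infoRate_eq (isStationaryChain_rll hθ) hε, rllCondEntropy,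
    condEntropy_pairLaw (isStationaryChain_rll hθ)]

lemma markovRates_eq {ε : ℝ} : markovRates ε = rllRate ε '' Icc 0 1 := by
  ext r
  constructor
  · rintro ⟨π, P, h, hs, rfl⟩
    obtain ⟨θ, hθ, hb⟩ := exists_blockLaw_eq_rll h hs
    refine ⟨θ, hθ, ?_⟩
    simp only [rllRate, infoRate]
    congr 1
    funext n
    simp only [blockInfo, hb]
  · rintro ⟨θ, hθ, rfl⟩
    exact ⟨_, _, isStationaryChain_rll hθ, supportedOn_rll, rfl⟩

/-! ### The entropies of the one-parameter family -/

/-- The eigenvalues of the matrix are $1$ and $-\theta$. -/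
lemma rllTrans_pow {θ : ℝ} (hθ : 1 + θ ≠ 0) (n : ℕ) :
    rllTrans θ ^ n = !![(1 + θ * (-θ) ^ n) / (1 + θ), θ * (1 - (-θ) ^ n) / (1 + θ);
      (1 - (-θ) ^ n) / (1 + θ), (θ + (-θ) ^ n) / (1 + θ)] := by
  induction n with
  | zero =>
    ext a b
    fin_cases a <;> fin_cases b <;> simp [hθ, add_comm θ 1]
  | succ n ih =>
    rw [pow_succ, ih, rllTrans]
    ext a b
    fin_cases a <;> fin_cases b <;> simp [Matrix.mul_apply, Fin.sum_univ_two] <;> field_simp <;> ring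

lemma rllCondEntropy_eq {θ : ℝ} (hθ : θ ∈ Icc (0 : ℝ) 1) (k : ℕ) :
    rllCondEntropy k θ =
      1 / (1 + θ) * (Real.negMulLog ((1 + θ * (-θ) ^ (k + 1)) / (1 + θ)) +
        Real.negMulLog (θ * (1 - (-θ) ^ (k + 1)) / (1 + θ))) +
      θ / (1 + θ) * (Real.negMulLog ((1 - (-θ) ^ (k + 1)) / (1 + θ)) +
        Real.negMulLog ((θ + (-θ) ^ (k + 1)) / (1 + θ))) := by
  have h : 1 + θ ≠ 0 := by linarith [hθ.1]
  rw [rllCondEntropy, condEntropy_pairLaw (isStationaryChain_rll hθ), stepEntropy,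
    rllTrans_pow h]
  simp [vecEntropy, rllInit, Fin.sum_univ_two]

lemma rllCondEntropy_nonneg {θ : ℝ} (hθ : θ ∈ Icc (0 : ℝ) 1) (k : ℕ) : 0 ≤ rllCondEntropy k θ := by
  rw [rllCondEntropy, condEntropy_pairLaw (isStationaryChain_rll hθ)]
  exact stepEntropy_nonneg (isStationaryChain_rll hθ) k

lemma rllCondEntropy_le {θ : ℝ} (hθ : θ ∈ Icc (0 : ℝ) 1) (k : ℕ) : rllCondEntropy k θ ≤ 1 := by
  rw [rllCondEntropy, condEntropy_pairLaw (isStationaryChain_rll hθ)]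
  exact stepEntropy_le (isStationaryChain_rll hθ) k

lemma rllCondEntropy_zero (k : ℕ) : rllCondEntropy k 0 = 0 := by
  rw [rllCondEntropy_eq (by simp)]
  simp

lemma rllCondEntropy_one (k : ℕ) : rllCondEntropy k 1 = 0 := by
  rw [rllCondEntropy_eq (by simp)]
  rcases neg_one_pow_eq_or ℝ (k + 1) with h | h <;> rw [h] <;> norm_num

lemma continuousOn_rllCondEntropy (k : ℕ) : ContinuousOn (rllCondEntropy k) (Icc 0 1) := by
  have h : ∀ θ ∈ Icc (0 : ℝ) 1, 1 + θ ≠ 0 := fun θ hθ => by linarith [hθ.1]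
  refine ContinuousOn.congr ?_ fun θ hθ => rllCondEntropy_eq hθ k
  have hc : ∀ f : ℝ → ℝ, ContinuousOn f (Icc 0 1) →
      ContinuousOn (fun θ => Real.negMulLog (f θ)) (Icc 0 1) := fun f hf =>
    Real.continuous_negMulLog.comp_continuousOn hf
  have hd : ∀ f : ℝ → ℝ, Continuous f → ContinuousOn (fun θ => f θ / (1 + θ)) (Icc 0 1) :=
    fun f hf => hf.continuousOn.div (by fun_prop) h
  exact ((hd _ continuous_const).mul ((hc _ (hd _ (by fun_prop))).add (hc _ (hd _ (by fun_prop))))).add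
    ((hd _ continuous_id).mul ((hc _ (hd _ (by fun_prop))).add (hc _ (hd _ (by fun_prop)))))

/-- The entropy of the letter after some steps, given the present letter, in terms of `θ` and of
`u = -(-θ) ^ k`. -/
def entropyForm (u θ : ℝ) : ℝ :=
  Real.log (1 + θ) - θ * (1 + θ)⁻¹ * Real.log θ -
    ((1 + θ) ^ 2)⁻¹ * (θ ^ 2 * ((1 + u) * Real.log (1 + u)) +
      (1 + u * θ ^ 2) * Real.log (1 + u * θ ^ 2) +
      2 * θ * ((1 - u * θ) * Real.log (1 - u * θ)))

lemma abs_neg_pow_lt_one {θ : ℝ} (hθ : θ ∈ Ioo (0 : ℝ) 1) {k : ℕ} (hk : k ≠ 0) :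
    |-(-θ) ^ k| < 1 := by
  rw [abs_neg, abs_pow, abs_neg, abs_of_pos hθ.1]
  exact pow_lt_one₀ hθ.1.le hθ.2 hk

lemma abs_neg_pow_le_one {θ : ℝ} (hθ : θ ∈ Ioo (0 : ℝ) 1) (k : ℕ) : |-(-θ) ^ k| ≤ 1 := by
  rw [abs_neg, abs_pow, abs_neg, abs_of_pos hθ.1]
  exact pow_le_one₀ hθ.1.le hθ.2.le

lemma pos_of_abs_le_one {u θ : ℝ} (hθ : θ ∈ Ioo (0 : ℝ) 1) (hu : |u| ≤ 1) :
    0 < 1 + u * θ ^ 2 ∧ 0 < 1 - u * θ := by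
  obtain ⟨h1, h2⟩ := abs_le.1 hu
  obtain ⟨h3, h4⟩ := hθ
  constructor <;> nlinarith

lemma rllCondEntropy_eq_entropyForm {θ : ℝ} (hθ : θ ∈ Ioo (0 : ℝ) 1) (k : ℕ) :
    rllCondEntropy k θ = entropyForm (-(-θ) ^ k) θ := by
  have hs : 1 + θ ≠ 0 := by linarith [hθ.1]
  have hθ0 := hθ.1.ne'
  rw [rllCondEntropy_eq ⟨hθ.1.le, hθ.2.le⟩]
  set u := -(-θ) ^ k with hu
  obtain ⟨h2, h3⟩ := pos_of_abs_le_one hθ (abs_neg_pow_le_one hθ k)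
  rw [← hu] at h2 h3
  have hρ : (-θ) ^ (k + 1) = u * θ := by rw [pow_succ, hu]; ring
  rw [hρ]
  have e1 : Real.negMulLog ((1 + θ * (u * θ)) / (1 + θ)) =
      (1 + u * θ ^ 2) / (1 + θ) * (Real.log (1 + θ) - Real.log (1 + u * θ ^ 2)) := by
    rw [show 1 + θ * (u * θ) = 1 + u * θ ^ 2 by ring, Real.negMulLog, Real.log_div h2.ne' hs]
    ring
  have e2 : Real.negMulLog (θ * (1 - u * θ) / (1 + θ)) =
      θ * (1 - u * θ) / (1 + θ) * (Real.log (1 + θ) - Real.log θ - Real.log (1 - u * θ)) := by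
    rw [Real.negMulLog, Real.log_div (mul_ne_zero hθ0 h3.ne') hs, Real.log_mul hθ0 h3.ne']
    ring
  have e3 : Real.negMulLog ((1 - u * θ) / (1 + θ)) =
      (1 - u * θ) / (1 + θ) * (Real.log (1 + θ) - Real.log (1 - u * θ)) := by
    rw [Real.negMulLog, Real.log_div h3.ne' hs]
    ring
  have e4 : Real.negMulLog ((θ + u * θ) / (1 + θ)) =
      θ * (1 + u) / (1 + θ) * (Real.log (1 + θ) - Real.log θ - Real.log (1 + u)) := by
    rw [show θ + u * θ = θ * (1 + u) by ring]
    -- This is the case $k=0$, where the transition from `2` to `2` has probability $0$.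
    by_cases h : 1 + u = 0
    · simp [h]
    rw [Real.negMulLog, Real.log_div (mul_ne_zero hθ0 h) hs, Real.log_mul hθ0 h]
    ring
  rw [e1, e2, e3, e4, entropyForm]
  field_simp
  ring

end BEC

end

noncomputable section

namespace BEC

/-! ### Concavity -/

/-- The derivative of the entropy with respect to `θ / (1 + θ)`. -/
def slopeForm (k u θ : ℝ) : ℝ :=
  -Real.log θ - θ / (1 + θ) * (2 + u * (k + 2 + k * θ)) *
      (Real.log (1 + u) + Real.log (1 + u * θ ^ 2) - 2 * Real.log (1 - u * θ)) -
    2 * Real.log (1 - u * θ) + 2 * Real.log (1 + u * θ ^ 2)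

/-- The derivative of `slopeForm` along `u = -(-θ) ^ k`, up to the factor `1 + θ`. -/
def curvatureForm (k u θ : ℝ) : ℝ :=
  -((2 + u * ((k + 1) * (k + 2) + 2 * k * (k + 2) * θ + k * (k + 1) * θ ^ 2)) *
      (Real.log (1 + u) + Real.log (1 + u * θ ^ 2) - 2 * Real.log (1 - u * θ))) / (1 + θ) -
    (1 + u * (k + 1 + k * θ)) ^ 2 / ((1 + u) * (1 - u * θ)) -
    (1 - θ * u * (k + 2 + (k + 1) * θ)) ^ 2 / (θ * (1 - u * θ) * (1 + u * θ ^ 2))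

section Derivatives

variable {u : ℝ → ℝ} {k θ : ℝ}

/-- The hypothesis $\theta u'=ku$ is all that is used of $u=-(-\theta)^k$. The strict bound on $|u|$
keeps $1+u$ positive and so excludes $k=0$. -/
lemma hasDerivAt_entropyForm (hθ : θ ∈ Ioo (0 : ℝ) 1) (hu : HasDerivAt u (k * u θ / θ) θ)
    (hu1 : |u θ| < 1) :
    HasDerivAt (fun t => entropyForm (u t) t) (slopeForm k (u θ) θ / (1 + θ) ^ 2) θ := by
  obtain ⟨h2, h3⟩ := pos_of_abs_le_one hθ hu1.le
  have h1 : 0 < 1 + u θ := by linarith [(abs_lt.1 hu1).1]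
  have h0 := hθ.1
  have hs : 0 < 1 + θ := by linarith
  have d1 : HasDerivAt (fun t => 1 + u t) (k * u θ / θ) θ := hu.const_add 1
  have d2 : HasDerivAt (fun t => 1 + u t * t ^ 2) (k * u θ / θ * θ ^ 2 + u θ * (2 * θ)) θ := by
    simpa using (hu.fun_mul (hasDerivAt_pow 2 θ)).const_add 1
  have d3 : HasDerivAt (fun t => 1 - u t * t) (-(k * u θ / θ * θ + u θ * 1)) θ :=
    (hu.fun_mul (hasDerivAt_id' θ)).const_sub 1
  have ds : HasDerivAt (fun t : ℝ => 1 + t) 1 θ := (hasDerivAt_id' θ).const_add 1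
  have dl := (((ds.log hs.ne').fun_sub
    (((hasDerivAt_id' θ).fun_mul (ds.fun_inv hs.ne')).fun_mul (Real.hasDerivAt_log h0.ne'))).fun_sub
    (((ds.fun_pow 2).fun_inv (by positivity)).fun_mul
      ((((hasDerivAt_pow 2 θ).fun_mul (d1.fun_mul (d1.log h1.ne'))).fun_add
        (d2.fun_mul (d2.log h2.ne'))).fun_add
        (((hasDerivAt_id' θ).const_mul 2).fun_mul (d3.fun_mul (d3.log h3.ne'))))))
  refine dl.congr_deriv ?_
  rw [slopeForm]
  have h1' := h1.ne'
  have h2' := h2.ne'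
  have h3' := h3.ne'
  have h0' := h0.ne'
  have hs' := hs.ne'
  clear dl d1 d2 d3 hu hu1 h1 h2 h3
  -- With the logarithms and their arguments as atoms, a rational identity remains.
  generalize u θ = v at *
  generalize Real.log (1 + v) = l1
  generalize Real.log (1 + v * θ ^ 2) = l2
  generalize Real.log (1 - v * θ) = l3
  generalize hA : 1 + v = A at *
  generalize hB : 1 + v * θ ^ 2 = B at *
  generalize hC : 1 - v * θ = C at *
  field_simp
  rw [← hA, ← hB, ← hC]
  ring

lemma hasDerivAt_slopeForm (hθ : θ ∈ Ioo (0 : ℝ) 1) (hu : HasDerivAt u (k * u θ / θ) θ)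
    (hu1 : |u θ| < 1) :
    HasDerivAt (fun t => slopeForm k (u t) t) (curvatureForm k (u θ) θ / (1 + θ)) θ := by
  obtain ⟨h2, h3⟩ := pos_of_abs_le_one hθ hu1.le
  have h1 : 0 < 1 + u θ := by linarith [(abs_lt.1 hu1).1]
  have h0 := hθ.1
  have hs : 0 < 1 + θ := by linarith
  have d1 : HasDerivAt (fun t => 1 + u t) (k * u θ / θ) θ := hu.const_add 1
  have d2 : HasDerivAt (fun t => 1 + u t * t ^ 2) (k * u θ / θ * θ ^ 2 + u θ * (2 * θ)) θ := by
    simpa using (hu.fun_mul (hasDerivAt_pow 2 θ)).const_add 1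
  have d3 : HasDerivAt (fun t => 1 - u t * t) (-(k * u θ / θ * θ + u θ * 1)) θ :=
    (hu.fun_mul (hasDerivAt_id' θ)).const_sub 1
  have ds : HasDerivAt (fun t : ℝ => 1 + t) 1 θ := (hasDerivAt_id' θ).const_add 1
  have db := (hu.fun_mul (((hasDerivAt_id' θ).const_mul k).const_add (k + 2))).const_add 2
  have dl := ((((Real.hasDerivAt_log h0.ne').fun_neg.fun_sub
    ((((hasDerivAt_id' θ).fun_div ds hs.ne').fun_mul db).fun_mul
      (((d1.log h1.ne').fun_add (d2.log h2.ne')).fun_sub ((d3.log h3.ne').const_mul 2)))).fun_sub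
    ((d3.log h3.ne').const_mul 2)).fun_add ((d2.log h2.ne').const_mul 2))
  refine dl.congr_deriv ?_
  rw [curvatureForm]
  have h1' := h1.ne'
  have h2' := h2.ne'
  have h3' := h3.ne'
  have h0' := h0.ne'
  have hs' := hs.ne'
  clear dl d1 d2 d3 db hu hu1 h1 h2 h3
  generalize u θ = v at *
  generalize Real.log (1 + v) = l1
  generalize Real.log (1 + v * θ ^ 2) = l2
  generalize Real.log (1 - v * θ) = l3
  generalize hA : 1 + v = A at *
  generalize hB : 1 + v * θ ^ 2 = B at *
  generalize hC : 1 - v * θ = C at *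
  field_simp
  rw [← hA, ← hB, ← hC]
  ring

end Derivatives

/-- The case of odd `k`: each of the three terms has the right sign. -/
lemma curvatureForm_nonpos_of_pos {k u θ : ℝ} (hk : 0 ≤ k) (hθ : θ ∈ Ioo (0 : ℝ) 1) (hu : 0 < u)
    (hu1 : u < 1) : curvatureForm k u θ ≤ 0 := by
  obtain ⟨h2, h3⟩ := pos_of_abs_le_one hθ (abs_le.2 ⟨by linarith, hu1.le⟩)
  have h0 := hθ.1
  have l1 : 0 ≤ Real.log (1 + u) := Real.log_nonneg (by linarith)
  have l2 : 0 ≤ Real.log (1 + u * θ ^ 2) := Real.log_nonneg (by nlinarith [mul_pos hu (pow_pos h0 2)])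
  have l3 : Real.log (1 - u * θ) ≤ 0 := Real.log_nonpos h3.le (by nlinarith [mul_pos hu h0])
  have t1 : 0 ≤ (2 + u * ((k + 1) * (k + 2) + 2 * k * (k + 2) * θ + k * (k + 1) * θ ^ 2)) *
      (Real.log (1 + u) + Real.log (1 + u * θ ^ 2) - 2 * Real.log (1 - u * θ)) / (1 + θ) := by
    refine div_nonneg (mul_nonneg (by positivity) (by linarith)) (by linarith)
  have t2 : 0 ≤ (1 + u * (k + 1 + k * θ)) ^ 2 / ((1 + u) * (1 - u * θ)) := by positivity
  have t3 : 0 ≤ (1 - θ * u * (k + 2 + (k + 1) * θ)) ^ 2 / (θ * (1 - u * θ) * (1 + u * θ ^ 2)) := by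
    positivity
  rw [curvatureForm, neg_div]
  linarith

/-- The case of even `k ≥ 2`, with `v = -u`. The combination `Λ` of logarithms is now negative, so
the first term can be positive; it is then dominated by the last square. -/
lemma curvatureForm_nonpos_of_neg {k v θ : ℝ} (hk : 2 ≤ k) (hθ : θ ∈ Ioo (0 : ℝ) 1) (hv : 0 < v)
    (hv1 : v < 1) : curvatureForm k (-v) θ ≤ 0 := by
  have ⟨h0, h1⟩ := hθ
  obtain ⟨h2, h3⟩ := pos_of_abs_le_one hθ (u := -v) (abs_le.2 ⟨by linarith, by linarith⟩)
  have hs : 0 < 1 + θ := by linarith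
  have hv2 : 0 < 1 + -v := by linarith
  set Λ := Real.log (1 + -v) + Real.log (1 + -v * θ ^ 2) - 2 * Real.log (1 - -v * θ) with hΛ
  set B := (k + 1) * (k + 2) + 2 * k * (k + 2) * θ + k * (k + 1) * θ ^ 2 with hB
  have hvθ : 0 < v * θ := mul_pos hv h0
  have l1 : Real.log (1 + -v) ≤ 0 := Real.log_nonpos hv2.le (by linarith)
  have l2 : Real.log (1 + -v * θ ^ 2) ≤ 0 :=
    Real.log_nonpos h2.le (by nlinarith [mul_pos hv (pow_pos h0 2)])
  have l3 : 0 ≤ Real.log (1 - -v * θ) := Real.log_nonneg (by linarith)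
  have t2 : 0 ≤ (1 + -v * (k + 1 + k * θ)) ^ 2 / ((1 + -v) * (1 - -v * θ)) := by positivity
  have hden : 0 < θ * (1 - -v * θ) * (1 + -v * θ ^ 2) := by positivity
  rw [curvatureForm, ← hΛ, ← hB]
  rcases le_or_gt (2 + -v * B) 0 with hb | hb
  · have t1 : 0 ≤ (2 + -v * B) * Λ / (1 + θ) :=
      div_nonneg (mul_nonneg_of_nonpos_of_nonpos hb (by linarith)) hs.le
    have t3 : 0 ≤ (1 - θ * -v * (k + 2 + (k + 1) * θ)) ^ 2 /
        (θ * (1 - -v * θ) * (1 + -v * θ ^ 2)) := by positivity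
    rw [neg_div]
    linarith
  -- $12$ is $(k+1)(k+2)$ at $k=2$, so $2-vB>0$ forces $v<1/6$. The factor $6/5=(1-1/6)^{-1}$ below
  -- comes from this bound.
  · have hB12 : 12 ≤ B := by
      have e1 : 0 ≤ 2 * k * (k + 2) * θ := by positivity
      have e2 : 0 ≤ k * (k + 1) * θ ^ 2 := by positivity
      nlinarith
    have hv6 : v < 1 / 6 := by nlinarith
    have hlog : ∀ x : ℝ, 0 ≤ x → x ≤ v → -Real.log (1 + -x) ≤ 6 / 5 * x := by
      intro x hx hxv
      have hx1 : 0 < 1 + -x := by linarith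
      have := Real.one_sub_inv_le_log_of_pos hx1
      have h5 : (1 + -x)⁻¹ ≤ 1 + 6 / 5 * x := by
        rw [inv_le_iff_one_le_mul₀ hx1]
        nlinarith
      linarith
    have l1' := hlog v hv.le le_rfl
    have l2' := hlog (v * θ ^ 2) (by positivity) (by nlinarith [pow_lt_one₀ h0.le h1 two_ne_zero])
    have l3' : Real.log (1 - -v * θ) ≤ v * θ := by
      have := Real.log_le_sub_one_of_pos h3
      linarith
    rw [show -(v * θ ^ 2) = -v * θ ^ 2 by ring] at l2'
    have hΛ' : -Λ ≤ 6 / 5 * v * (1 + θ) ^ 2 := by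
      have : 6 / 5 * v * (1 + θ) ^ 2 = 6 / 5 * v + 12 / 5 * (v * θ) + 6 / 5 * (v * θ ^ 2) := by ring
      linarith
    have hΛ0 : 0 ≤ -Λ := by linarith
    have t1 : -((2 + -v * B) * Λ) / (1 + θ) ≤ 12 / 5 * v * (1 + θ) := by
      rw [div_le_iff₀ hs]
      have : (2 + -v * B) * -Λ ≤ 2 * -Λ := by
        refine mul_le_mul_of_nonneg_right ?_ hΛ0
        have : 0 < v * B := by positivity
        linarith
      calc -((2 + -v * B) * Λ) = (2 + -v * B) * -Λ := by ring
        _ ≤ 2 * (6 / 5 * v * (1 + θ) ^ 2) := by linarith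
        _ = 12 / 5 * v * (1 + θ) * (1 + θ) := by ring
    -- The numerator is at least $1$ and the denominator at most $\frac76\theta$; the constants fit
    -- because $\frac{12}5\cdot\frac76\cdot\frac13=\frac{14}{15}<1$.
    have t3 : 12 / 5 * v * (1 + θ) ≤ (1 - θ * -v * (k + 2 + (k + 1) * θ)) ^ 2 /
        (θ * (1 - -v * θ) * (1 + -v * θ ^ 2)) := by
      have e1 : 1 ≤ (1 - θ * -v * (k + 2 + (k + 1) * θ)) ^ 2 := by
        refine one_le_pow₀ ?_
        have : 0 ≤ θ * v * (k + 2 + (k + 1) * θ) := by positivity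
        linarith
      have e2 : θ * (1 - -v * θ) * (1 + -v * θ ^ 2) ≤ 7 / 6 * θ := by
        have e3 : 1 - -v * θ ≤ 7 / 6 := by linarith [mul_le_of_le_one_right hv.le h1.le]
        have e4 : 1 + -v * θ ^ 2 ≤ 1 := by linarith [mul_pos hv (pow_pos h0 2)]
        calc θ * (1 - -v * θ) * (1 + -v * θ ^ 2) ≤ θ * (1 - -v * θ) * 1 :=
              mul_le_mul_of_nonneg_left e4 (by positivity)
          _ ≤ θ * (7 / 6) * 1 := by gcongr
          _ = 7 / 6 * θ := by ring
      rw [le_div_iff₀ hden]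
      have e5 : 0 ≤ 12 / 5 * v * (1 + θ) := by positivity
      have e6 : v * (1 + θ) * θ ≤ 1 / 3 := by
        have : (1 + θ) * θ ≤ 2 * 1 := mul_le_mul (by linarith) h1.le h0.le (by norm_num)
        calc v * (1 + θ) * θ = v * ((1 + θ) * θ) := by ring
          _ ≤ 1 / 6 * (2 * 1) := mul_le_mul hv6.le this (by positivity) (by norm_num)
          _ = 1 / 3 := by norm_num
      calc 12 / 5 * v * (1 + θ) * (θ * (1 - -v * θ) * (1 + -v * θ ^ 2))
          ≤ 12 / 5 * v * (1 + θ) * (7 / 6 * θ) := mul_le_mul_of_nonneg_left e2 e5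
        _ = 14 / 5 * (v * (1 + θ) * θ) := by ring
        _ ≤ 1 := by linarith
        _ ≤ _ := e1
    linarith

/-- `(1 + θ)²` times the derivative of the `k`-th entropy. -/
def rllSlope (k : ℕ) (θ : ℝ) : ℝ := slopeForm k (-(-θ) ^ k) θ

lemma hasDerivAt_neg_neg_pow {k : ℕ} {θ : ℝ} (hθ : θ ≠ 0) :
    HasDerivAt (fun t : ℝ => -(-t) ^ k) (k * -(-θ) ^ k / θ) θ := by
  have := (((hasDerivAt_id' θ).fun_neg).fun_pow k).fun_neg
  refine this.congr_deriv ?_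
  rcases k with _ | k
  · simp
  · simp only [Nat.add_sub_cancel, pow_succ]
    field_simp

lemma rllCondEntropy_eventuallyEq {θ : ℝ} (hθ : θ ∈ Ioo (0 : ℝ) 1) (k : ℕ) :
    rllCondEntropy k =ᶠ[𝓝 θ] fun t => entropyForm (-(-t) ^ k) t := by
  filter_upwards [isOpen_Ioo.mem_nhds hθ] with t ht using rllCondEntropy_eq_entropyForm ht k

/-- At $k=0$, $u=-1$ the factor $2+u(k+2+k\theta)$ vanishes, so the default value of `Real.log 0` is
harmless. -/
lemma rllSlope_zero {θ : ℝ} (hθ : θ ∈ Ioo (0 : ℝ) 1) :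
    rllSlope 0 θ = -Real.log θ + 2 * Real.log (1 - θ) := by
  have ⟨h0, h1⟩ := hθ
  have e : 1 + -1 * θ ^ 2 = (1 - θ) * (1 + θ) := by ring
  have e' : 1 - -1 * θ = 1 + θ := by ring
  simp only [rllSlope, slopeForm, pow_zero, Nat.cast_zero, e, e']
  rw [Real.log_mul (by linarith) (by linarith)]
  ring

lemma hasDerivAt_rllCondEntropy {θ : ℝ} (hθ : θ ∈ Ioo (0 : ℝ) 1) (k : ℕ) :
    HasDerivAt (rllCondEntropy k) (rllSlope k θ / (1 + θ) ^ 2) θ := by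
  rcases eq_or_ne k 0 with rfl | hk
  · have ⟨h0, h1⟩ := hθ
    have hs : 1 + θ ≠ 0 := by linarith
    have h1' : 1 - θ ≠ 0 := by linarith
    have hf : rllCondEntropy 0 =ᶠ[𝓝 θ] fun t =>
        (-(t * Real.log t) - (1 - t) * Real.log (1 - t)) / (1 + t) := by
      filter_upwards [isOpen_Ioo.mem_nhds hθ] with t ht
      have hs : 1 + t ≠ 0 := by linarith [ht.1]
      have e : 1 + -1 * t ^ 2 = (1 - t) * (1 + t) := by ring
      have e' : 1 - -1 * t = 1 + t := by ring
      rw [rllCondEntropy_eq_entropyForm ht]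
      simp only [entropyForm, pow_zero, e, e']
      rw [Real.log_mul (by linarith [ht.2]) hs]
      field_simp
      ring_nf
    rw [hf.hasDerivAt_iff, rllSlope_zero hθ]
    have d1 : HasDerivAt (fun t : ℝ => 1 - t) (-1) θ := (hasDerivAt_id' θ).const_sub 1
    have := ((((hasDerivAt_id' θ).fun_mul (Real.hasDerivAt_log h0.ne')).fun_neg).fun_sub
      (d1.fun_mul (d1.log h1'))).fun_div ((hasDerivAt_id' θ).const_add 1) hs
    refine this.congr_deriv ?_
    field_simp
    ring
  · rw [(rllCondEntropy_eventuallyEq hθ k).hasDerivAt_iff]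
    exact hasDerivAt_entropyForm hθ (hasDerivAt_neg_neg_pow hθ.1.ne') (abs_neg_pow_lt_one hθ hk)

/-- Strictness is recorded only for `k = 0`: the weight $\varepsilon^0=1$ is positive even at
$\varepsilon=0$, so this one term makes the whole sum strict. -/
lemma exists_hasDerivAt_rllSlope {θ : ℝ} (hθ : θ ∈ Ioo (0 : ℝ) 1) (k : ℕ) :
    ∃ c ≤ 0, HasDerivAt (rllSlope k) c θ ∧ (k = 0 → c < 0) := by
  have ⟨h0, h1⟩ := hθ
  rcases eq_or_ne k 0 with rfl | hk
  · have hf : rllSlope 0 =ᶠ[𝓝 θ] fun t => -Real.log t + 2 * Real.log (1 - t) := by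
      filter_upwards [isOpen_Ioo.mem_nhds hθ] with t ht using rllSlope_zero ht
    have d1 : HasDerivAt (fun t : ℝ => 1 - t) (-1) θ := (hasDerivAt_id' θ).const_sub 1
    have hd := (Real.hasDerivAt_log h0.ne').fun_neg.fun_add
      ((d1.log (by linarith)).const_mul 2)
    have hneg : -θ⁻¹ + 2 * (-1 / (1 - θ)) < 0 := by
      have : 0 < θ⁻¹ := by positivity
      have : 0 < 1 / (1 - θ) := one_div_pos.2 (by linarith)
      rw [neg_div]
      linarith
    exact ⟨_, hneg.le, hf.hasDerivAt_iff.2 hd, fun _ => hneg⟩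
  · refine ⟨_, ?_, hasDerivAt_slopeForm hθ (hasDerivAt_neg_neg_pow h0.ne')
      (abs_neg_pow_lt_one hθ hk), fun h => absurd h hk⟩
    have hv := pow_pos h0 k
    have hv1 := pow_lt_one₀ h0.le h1 hk
    refine div_nonpos_of_nonpos_of_nonneg ?_ (by linarith)
    rcases Nat.even_or_odd k with he | ho
    · rw [he.neg_pow]
      have : 2 ≤ k := by obtain ⟨m, rfl⟩ := he; omega
      exact curvatureForm_nonpos_of_neg (by exact_mod_cast this) hθ hv hv1
    · rw [ho.neg_pow, neg_neg]
      exact curvatureForm_nonpos_of_pos k.cast_nonneg hθ hv hv1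

end BEC

end

noncomputable section

namespace BEC

open scoped BoundedContinuousFunction

/-! ### Analytic families of bounded sequences -/

section PowerSeries

variable {V : Type*} [NormedAddCommGroup V] [NormedSpace ℝ V] [CompleteSpace V]

lemma summable_pow_smul {c : ℕ → V} (hc : ∀ n, ‖c n‖ ≤ 1) {t : ℝ} (ht : t ∈ Metric.ball (0 : ℝ) 1) :
    Summable fun n => t ^ n • c n := by
  rw [mem_ball_zero_iff] at ht
  refine Summable.of_norm_bounded (summable_geometric_of_lt_one (norm_nonneg t) ht) fun n => ?_
  rw [norm_smul, norm_pow]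
  exact mul_le_of_le_one_right (by positivity) (hc n)

/-- Used with `V` the space of bounded sequences and with `V` its dual. -/
lemma analyticOnNhd_tsum_pow_smul {c : ℕ → V} (hc : ∀ n, ‖c n‖ ≤ 1) :
    AnalyticOnNhd ℝ (fun t : ℝ => ∑' n, t ^ n • c n) (Metric.ball 0 1) := by
  set p : FormalMultilinearSeries ℝ ℝ V := fun n => ContinuousMultilinearMap.mkPiRing ℝ (Fin n) (c n)
  have hr : ((1 : NNReal) : ENNReal) ≤ p.radius := by
    refine p.le_radius_of_bound 1 fun n => ?_
    simpa [p] using hc n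
  have hr0 : 0 < p.radius := lt_of_lt_of_le (by simp) hr
  have h := (p.hasFPowerSeriesOnBall hr0).analyticOnNhd
  have hs : p.sum = fun t : ℝ => ∑' n, t ^ n • c n := by
    funext t
    simp [FormalMultilinearSeries.sum, p]
  rw [hs] at h
  refine h.mono fun t ht => ?_
  rw [mem_ball_zero_iff] at ht
  refine Metric.mem_eball.2 (lt_of_lt_of_le ?_ hr)
  rw [edist_zero_right, ← ofReal_norm]
  simpa using ht

end PowerSeries

/-- A bound on the coefficients uniform in `k` turns a family of power series into one power series
with coefficients in the sup norm. -/
lemma exists_analytic_seq {c : ℕ → ℕ → ℝ} (hc : ∀ k j, |c k j| ≤ 1) :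
    ∃ f : ℝ → ℕ →ᵇ ℝ, AnalyticOnNhd ℝ f (Metric.ball 0 1) ∧
      ∀ t ∈ Metric.ball (0 : ℝ) 1, ∀ k, HasSum (fun j => t ^ j * c k j) (f t k) := by
  set C : ℕ → ℕ →ᵇ ℝ := fun j =>
    BoundedContinuousFunction.ofNormedAddCommGroupDiscrete (fun k => c k j) 1 fun k => hc k j
  have hC : ∀ j, ‖C j‖ ≤ 1 := fun j =>
    (BoundedContinuousFunction.norm_le zero_le_one).2 fun k => hc k j
  refine ⟨_, analyticOnNhd_tsum_pow_smul hC, fun t ht k => ?_⟩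
  simpa [C] using (summable_pow_smul hC ht).hasSum.mapL (BoundedContinuousFunction.evalCLM ℝ k)

lemma exists_analytic_seq_pow {s : ℕ → ℝ} (hs : ∀ k, |s k| ≤ 1) :
    ∃ f : ℝ → ℕ →ᵇ ℝ, AnalyticOnNhd ℝ f (Metric.ball 0 1) ∧
      ∀ t ∈ Metric.ball (0 : ℝ) 1, ∀ k, f t k = s k * t ^ k := by
  obtain ⟨f, hf, hsum⟩ := exists_analytic_seq (c := fun k j => if j = k then s k else 0)
    fun k j => by split_ifs <;> simp [hs]
  refine ⟨f, hf, fun t ht k => (hsum t ht k).unique ?_⟩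
  convert hasSum_single k fun j hj => ?_ using 1
  · simp [mul_comm]
  · simp [hj]

lemma exists_analytic_seq_log {s : ℕ → ℝ} (hs : ∀ k, |s k| ≤ 1) {m : ℕ → ℕ} (hm : ∀ k, m k ≠ 0) :
    ∃ f : ℝ → ℕ →ᵇ ℝ, AnalyticOnNhd ℝ f (Metric.ball 0 1) ∧
      ∀ t ∈ Metric.ball (0 : ℝ) 1, ∀ k, f t k = Real.log (1 - s k * t ^ m k) := by
  obtain ⟨f, hf, hsum⟩ := exists_analytic_seq
    -- These are the coefficients of $\log(1-s_kt^{m_k})$; at `j = 0` the quotient is $1/0=0$, the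
    -- correct constant term.
    (c := fun k j => if m k ∣ j then -(s k ^ (j / m k) / (j / m k : ℕ)) else 0) fun k j => by
      split_ifs
      · rw [abs_neg, abs_div, abs_pow, Nat.abs_cast]
        rcases (j / m k).eq_zero_or_pos with h | h
        · simp [h]
        · exact div_le_one_of_le₀ ((pow_le_one₀ (abs_nonneg _) (hs k)).trans
            (by exact_mod_cast h)) (Nat.cast_nonneg _)
      · simp
  refine ⟨f, hf, fun t ht k => (hsum t ht k).unique ?_⟩
  have ht' : |t| < 1 := by simpa using ht
  have hx : |s k * t ^ m k| < 1 := by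
    rw [abs_mul, abs_pow]
    exact mul_lt_one_of_nonneg_of_lt_one_right (hs k) (by positivity)
      (pow_lt_one₀ (abs_nonneg t) ht' (hm k))
  have hlog := (Real.hasSum_pow_div_log_of_abs_lt_one hx).neg
  rw [neg_neg] at hlog
  have hinj : Function.Injective fun i : ℕ => m k * (i + 1) := fun i j h => by
    simpa [hm k] using h
  rw [← hinj.hasSum_iff]
  · have hmk : 0 < m k := Nat.pos_of_ne_zero (hm k)
    have heq : ∀ i : ℕ, t ^ (m k * (i + 1)) * -(s k ^ (i + 1) / ((i + 1 : ℕ) : ℝ)) =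
        -((s k * t ^ m k) ^ (i + 1) / (i + 1)) := fun i => by
      rw [mul_pow, ← pow_mul]
      push_cast
      ring
    simpa only [Function.comp_def, dvd_mul_right, if_true, Nat.mul_div_cancel_left _ hmk, heq]
      using hlog
  · intro j hj
    by_cases hd : m k ∣ j
    · obtain ⟨i, rfl⟩ := hd
      rcases i with _ | i
      · simp
      · exact absurd ⟨i, rfl⟩ hj
    · simp [hd]

/-- The entropies, as a bounded sequence, depend analytically on the parameter. -/
theorem exists_analytic_entropies : ∃ H : ℝ → ℕ →ᵇ ℝ, AnalyticOnNhd ℝ H (Ioo 0 1) ∧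
    ∀ θ ∈ Ioo (0 : ℝ) 1, ∀ k, H θ k = rllCondEntropy k θ := by
  have hs : ∀ k : ℕ, |(-1 : ℝ) ^ k| ≤ 1 := by simp
  have hs' : ∀ k : ℕ, |-(-1 : ℝ) ^ k| ≤ 1 := by simp
  obtain ⟨U, hU, eU⟩ := exists_analytic_seq_pow hs'
  -- At `k = 0` the logarithm is multiplied by $1+u=0$, so any nonzero exponent will do.
  obtain ⟨L₁, hL₁, e₁⟩ := exists_analytic_seq_log hs (m := fun k => if k = 0 then 1 else k)
    fun k => by split_ifs with h <;> simp [h]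
  obtain ⟨L₂, hL₂, e₂⟩ := exists_analytic_seq_log hs (m := fun k => k + 2) fun k => by simp
  obtain ⟨L₃, hL₃, e₃⟩ := exists_analytic_seq_log hs' (m := fun k => k + 1) fun k => by simp
  have hball : ∀ {θ : ℝ}, θ ∈ Ioo (0 : ℝ) 1 → θ ∈ Metric.ball (0 : ℝ) 1 := fun {θ} h => by
    simpa [abs_of_pos h.1] using h.2
  refine ⟨fun θ => (Real.log (1 + θ) - θ * (1 + θ)⁻¹ * Real.log θ) • (1 : ℕ →ᵇ ℝ) -
    ((1 + θ) ^ 2)⁻¹ • (θ ^ 2 • ((1 + U θ) * L₁ θ) + (1 + θ ^ 2 • U θ) * L₂ θ +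
      (2 * θ) • ((1 - θ • U θ) * L₃ θ)), fun θ hθ => ?_, fun θ hθ k => ?_⟩
  · have a0 := hU θ (hball hθ)
    have a1 := hL₁ θ (hball hθ)
    have a2 := hL₂ θ (hball hθ)
    have a3 := hL₃ θ (hball hθ)
    have hs : 0 < 1 + θ := by linarith [hθ.1]
    have b1 : AnalyticAt ℝ (fun θ : ℝ => 1 + θ) θ := by fun_prop
    have b2 := b1.log hs
    have b3 := b1.inv hs.ne'
    have b4 := (b1.pow 2).inv (pow_ne_zero 2 hs.ne')
    have b5 := (analyticAt_id (𝕜 := ℝ) (z := θ)).log hθ.1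
    have b6 : AnalyticAt ℝ (fun θ : ℝ => θ) θ := analyticAt_id
    exact ((b2.sub ((b6.mul b3).mul b5)).smul analyticAt_const).sub
      (b4.smul ((((b6.pow 2).smul ((analyticAt_const.add a0).mul a1)).add
        ((analyticAt_const.add ((b6.pow 2).smul a0)).mul a2)).add
        ((analyticAt_const.mul b6).smul ((analyticAt_const.sub (b6.smul a0)).mul a3))))
  · rw [rllCondEntropy_eq_entropyForm hθ, entropyForm]
    have hu : U θ k = -(-θ) ^ k := by
      rw [eU θ (hball hθ), neg_pow θ]
      ring
    have h2 : L₂ θ k = Real.log (1 + -(-θ) ^ k * θ ^ 2) := by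
      rw [e₂ θ (hball hθ), neg_pow θ]
      ring_nf
    have h3 : L₃ θ k = Real.log (1 - -(-θ) ^ k * θ) := by
      rw [e₃ θ (hball hθ), neg_pow θ]
      ring_nf
    have h1 : (1 + -(-θ) ^ k) * L₁ θ k = (1 + -(-θ) ^ k) * Real.log (1 + -(-θ) ^ k) := by
      rcases eq_or_ne k 0 with rfl | hk
      · simp
      · rw [e₁ θ (hball hθ), neg_pow θ, if_neg hk, sub_eq_add_neg]
    simp only [BoundedContinuousFunction.coe_sub, BoundedContinuousFunction.coe_smul,
      BoundedContinuousFunction.coe_add, BoundedContinuousFunction.coe_mul,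
      BoundedContinuousFunction.coe_one, Pi.sub_apply, Pi.add_apply, Pi.mul_apply, Pi.one_apply,
      smul_eq_mul, mul_one, hu, h2, h3, h1]
    ring

end BEC

end

noncomputable section

namespace BEC

open scoped BoundedContinuousFunction

/-! ### Evaluation of a bounded sequence as a power series -/

/-- The functional that sends a bounded sequence `x` to `∑ ε ^ k * x k`. -/
def geomEval (ε : ℝ) : (ℕ →ᵇ ℝ) →L[ℝ] ℝ :=
  ∑' k, ε ^ k • BoundedContinuousFunction.evalCLM ℝ k

lemma norm_evalCLM_le (k : ℕ) :
    ‖(BoundedContinuousFunction.evalCLM ℝ k : (ℕ →ᵇ ℝ) →L[ℝ] ℝ)‖ ≤ 1 :=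
  ContinuousLinearMap.opNorm_le_bound _ zero_le_one fun x => by
    simpa using x.norm_coe_le_norm k

lemma analyticOnNhd_geomEval : AnalyticOnNhd ℝ geomEval (Metric.ball 0 1) :=
  analyticOnNhd_tsum_pow_smul norm_evalCLM_le

lemma hasSum_geomEval {ε : ℝ} (hε : ε ∈ Metric.ball (0 : ℝ) 1) (x : ℕ →ᵇ ℝ) :
    HasSum (fun k => ε ^ k * x k) (geomEval ε x) := by
  have h : HasSum (fun k => ε ^ k • (BoundedContinuousFunction.evalCLM ℝ k : (ℕ →ᵇ ℝ) →L[ℝ] ℝ))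
      (geomEval ε) := by
    have hsum := summable_pow_smul (V := (ℕ →ᵇ ℝ) →L[ℝ] ℝ)
      (c := fun k => BoundedContinuousFunction.evalCLM ℝ k) norm_evalCLM_le hε
    exact hsum.hasSum
  have h2 := (ContinuousLinearMap.apply ℝ ℝ x).hasSum h
  simpa only [ContinuousLinearMap.apply_apply, _root_.smul_apply, smul_eq_mul,
    BoundedContinuousFunction.evalCLM_apply] using h2

/-- The pullback of bounded sequences along a partial map of the indices. -/
def reindex (f : ℕ → Option ℕ) : (ℕ →ᵇ ℝ) →L[ℝ] (ℕ →ᵇ ℝ) :=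
  LinearMap.mkContinuous
    { toFun := fun x => BoundedContinuousFunction.ofNormedAddCommGroupDiscrete
        (fun k => (f k).elim 0 x) ‖x‖ fun k => by
          cases f k with
          | none => simp
          | some j => simpa using x.norm_coe_le_norm j
      map_add' := fun x y => by ext k; cases h : f k <;> simp [h]
      map_smul' := fun c x => by ext k; cases h : f k <;> simp [h] } 1 fun x => by
    rw [one_mul]
    refine (BoundedContinuousFunction.norm_le (norm_nonneg x)).2 fun k => ?_
    cases h : f k with
    | none => simp [h]
    | some j => simpa [h] using x.norm_coe_le_norm j

/-- The shift of a sequence that drops its first entry. -/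
def leftShift : (ℕ →ᵇ ℝ) →L[ℝ] (ℕ →ᵇ ℝ) := reindex fun k => some (k + 1)

/-- The shift of a sequence that puts a zero in front. -/
def rightShift : (ℕ →ᵇ ℝ) →L[ℝ] (ℕ →ᵇ ℝ) :=
  reindex fun k => match k with
    | 0 => none
    | k + 1 => some k

@[simp] lemma leftShift_apply (x : ℕ →ᵇ ℝ) (k : ℕ) : leftShift x k = x (k + 1) := rfl

@[simp] lemma rightShift_zero (x : ℕ →ᵇ ℝ) : rightShift x 0 = 0 := rfl

@[simp] lemma rightShift_succ (x : ℕ →ᵇ ℝ) (k : ℕ) : rightShift x (k + 1) = x k := rfl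

/-- Horner's step, the engine of the induction in `iteratedDeriv_geomEval`. -/
lemma geomEval_eq_add {ε : ℝ} (hε : ε ∈ Metric.ball (0 : ℝ) 1) (x : ℕ →ᵇ ℝ) :
    geomEval ε x = x 0 + ε * geomEval ε (leftShift x) := by
  have h1 := (hasSum_geomEval hε (leftShift x)).mul_left ε
  have h2 : HasSum (fun k => ε ^ (k + 1) * x (k + 1)) (ε * geomEval ε (leftShift x)) := by
    simpa only [leftShift_apply, pow_succ', mul_assoc] using h1
  simpa using (hasSum_geomEval hε x).unique h2.zero_add

lemma geomEval_rightShift {ε : ℝ} (hε : ε ∈ Metric.ball (0 : ℝ) 1) (x : ℕ →ᵇ ℝ) :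
    geomEval ε (rightShift x) = ε * geomEval ε x := by
  rw [geomEval_eq_add hε, rightShift_zero, zero_add]
  congr 2

lemma zero_mem_unit_ball : (0 : ℝ) ∈ Metric.ball (0 : ℝ) 1 := by simp

lemma analyticAt_geomEval_apply {K : ℝ → ℕ →ᵇ ℝ} {ε : ℝ} (hε : ε ∈ Metric.ball (0 : ℝ) 1)
    (hK : AnalyticAt ℝ K ε) : AnalyticAt ℝ (fun t => geomEval t (K t)) ε :=
  (ContinuousLinearMap.analyticAt_bilinear (ContinuousLinearMap.id ℝ ((ℕ →ᵇ ℝ) →L[ℝ] ℝ))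
    (geomEval ε, K ε)).comp₂ (analyticOnNhd_geomEval ε hε) hK

lemma analyticAt_seq_apply {K : ℝ → ℕ →ᵇ ℝ} {ε : ℝ} (hK : AnalyticAt ℝ K ε) (k : ℕ) :
    AnalyticAt ℝ (fun t => K t k) ε :=
  ((BoundedContinuousFunction.evalCLM ℝ k : (ℕ →ᵇ ℝ) →L[ℝ] ℝ).analyticAt (K ε)).comp hK

lemma iteratedDeriv_id_mul {g : ℝ → ℝ} (hg : AnalyticAt ℝ g 0) (n : ℕ) :
    iteratedDeriv n (fun t => t * g t) 0 = n * iteratedDeriv (n - 1) g 0 := by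
  rw [iteratedDeriv_fun_mul (f := fun t => t) contDiffAt_id hg.contDiffAt]
  simp only [show (fun i : ℝ => i) = id from rfl, iteratedDeriv_id]
  rcases n with _ | n
  · simp
  · rw [Finset.sum_eq_single 1]
    · simp
    · intro i _ hi
      by_cases h : i = 0 <;> simp [h, hi]
    · simp

/-- The derivatives at `0` of a power series whose coefficients depend on the variable. -/
theorem iteratedDeriv_geomEval (n : ℕ) {K : ℝ → ℕ →ᵇ ℝ} (hK : AnalyticAt ℝ K 0) :
    iteratedDeriv n (fun t => geomEval t (K t)) 0 =
      ∑ k ∈ Finset.range (n + 1), (n.choose k : ℝ) * (k ! : ℝ) *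
        iteratedDeriv (n - k) (fun t => K t k) 0 := by
  induction n generalizing K with
  | zero =>
    simpa using geomEval_eq_add zero_mem_unit_ball (K 0)
  | succ n ih =>
    have hev : (fun t => geomEval t (K t)) =ᶠ[𝓝 0]
        fun t => K t 0 + t * geomEval t (leftShift (K t)) := by
      filter_upwards [Metric.isOpen_ball.mem_nhds zero_mem_unit_ball] with t ht
        using geomEval_eq_add ht _
    have hS : AnalyticAt ℝ (fun t => leftShift (K t)) 0 := (leftShift.analyticAt _).comp hK
    have hg := analyticAt_geomEval_apply zero_mem_unit_ball hS
    have hm : AnalyticAt ℝ (fun t => t * geomEval t (leftShift (K t))) 0 := analyticAt_id.mul hg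
    rw [hev.iteratedDeriv_eq, iteratedDeriv_fun_add (analyticAt_seq_apply hK 0).contDiffAt
      hm.contDiffAt, iteratedDeriv_id_mul hg, Nat.add_sub_cancel, ih hS, Finset.sum_range_succ' _ (n + 1),
      Finset.mul_sum, add_comm]
    congr 1
    · refine Finset.sum_congr rfl fun k _ => ?_
      simp only [leftShift_apply, Nat.add_sub_add_right]
      have : ((n + 1 : ℕ) : ℝ) * ((n.choose k : ℝ) * (k ! : ℝ)) =
          ((n + 1).choose (k + 1) : ℝ) * ((k + 1)! : ℝ) := by
        have := Nat.add_one_mul_choose_eq n k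
        have h2 := congrArg (fun i : ℕ => (i : ℝ)) this
        push_cast at h2 ⊢
        rw [Nat.factorial_succ]
        push_cast
        linear_combination (k ! : ℝ) * h2
      rw [← this]
      ring
    · simp

/-! ### The formula of Faà di Bruno -/

lemma iteratedDeriv_pow_succ_mul {g : ℝ → ℝ} (hg : AnalyticAt ℝ g 0) (n : ℕ) :
    iteratedDeriv n (fun t => t ^ (n + 1) * g t) 0 = 0 := by
  rw [iteratedDeriv_fun_mul (by fun_prop) hg.contDiffAt]
  refine Finset.sum_eq_zero fun i hi => ?_
  have : i ≠ n + 1 := by have := Finset.mem_range.1 hi; omega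
  rw [iteratedDeriv_fun_pow_zero, if_neg this]
  simp

/-- Taylor's formula for a composition. -/
lemma iteratedDeriv_comp_eq_of_taylor {f τ : ℝ → ℝ} (hτ : AnalyticAt ℝ τ 0)
    (hf : AnalyticAt ℝ f (τ 0)) (N : ℕ) :
    iteratedDeriv N (fun t => f (τ t)) 0 = iteratedDeriv N (fun t =>
      ∑ M ∈ Finset.range (N + 1), iteratedDeriv M f (τ 0) / (M ! : ℝ) *
        (∑ i : Fin N, iteratedDeriv ((i : ℕ) + 1) τ 0 / (((i : ℕ) + 1)! : ℝ) *
          t ^ ((i : ℕ) + 1)) ^ M) 0 := by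
  set c : ℕ → ℝ := fun M => iteratedDeriv M f (τ 0) / (M ! : ℝ) with hc
  set y : ℝ → ℝ := fun t => ∑ i : Fin N, iteratedDeriv ((i : ℕ) + 1) τ 0 / (((i : ℕ) + 1)! : ℝ) *
          t ^ ((i : ℕ) + 1) with hy
  obtain ⟨F, hF, eF⟩ := hτ.exists_eventuallyEq_sum_add_pow_mul (N + 1)
  obtain ⟨F₁, hF₁, eF₁⟩ := hτ.exists_eventuallyEq_sum_add_pow_mul 1
  have hf' : AnalyticAt ℝ (fun z => f (τ 0 + z)) 0 := by
    refine AnalyticAt.fun_comp (g := f) (f := fun z => τ 0 + z) ?_ (by fun_prop)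
    simpa using hf
  obtain ⟨F₂, hF₂, eF₂⟩ := hf'.exists_eventuallyEq_sum_add_pow_mul (N + 1)
  have hψ : AnalyticAt ℝ (fun t => τ t - τ 0) 0 := hτ.sub analyticAt_const
  have hyA : AnalyticAt ℝ y 0 := by
    refine Finset.analyticAt_fun_sum _ fun i _ => ?_
    fun_prop
  have eψ : ∀ᶠ t in 𝓝 (0 : ℝ), τ t - τ 0 = y t + t ^ (N + 1) * F t := by
    filter_upwards [eF] with t ht
    rw [ht, Finset.sum_range_succ']
    simp only [hy, smul_eq_mul, pow_zero, Nat.factorial_zero, Nat.cast_one, div_one, one_mul,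
      iteratedDeriv_zero, Finset.sum_range]
    have : ∀ i : Fin N, t ^ ((i : ℕ) + 1) / (((i : ℕ) + 1)! : ℝ) * iteratedDeriv ((i : ℕ) + 1) τ 0 =
        iteratedDeriv ((i : ℕ) + 1) τ 0 / (((i : ℕ) + 1)! : ℝ) * t ^ ((i : ℕ) + 1) := fun i => by ring
    simp only [this]
    ring
  have eψ₁ : ∀ᶠ t in 𝓝 (0 : ℝ), τ t - τ 0 = t * F₁ t := by
    filter_upwards [eF₁] with t ht
    simp [ht]
  have htend : Tendsto (fun t => τ t - τ 0) (𝓝 0) (𝓝 0) := by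
    have := hψ.continuousAt.tendsto
    simpa using this
  have eψ₂ := htend.eventually eF₂
  -- The error is divisible by $t^{N+1}$ for two reasons: `geom_sum₂_mul` extracts the factor
  -- $x-y=t^{N+1}F$ from $x^M-y^M$, where $x=\tau(t)-\tau(0)$, and the Taylor remainder of `f`
  -- carries $x^{N+1}=t^{N+1}F_1^{N+1}$.
  set g : ℝ → ℝ := fun t => ∑ M ∈ Finset.range (N + 1), c M * (F t *
      ∑ i ∈ Finset.range M, (τ t - τ 0) ^ i * y t ^ (M - 1 - i)) +
      F₁ t ^ (N + 1) * F₂ (τ t - τ 0) with hg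
  have hgA : AnalyticAt ℝ g 0 := by
    refine AnalyticAt.add (Finset.analyticAt_fun_sum _ fun M _ => analyticAt_const.mul (hF.mul
      (Finset.analyticAt_fun_sum _ fun i _ => (hψ.pow i).mul (hyA.pow _)))) ((hF₁.pow _).mul ?_)
    refine AnalyticAt.fun_comp (g := F₂) (f := fun t => τ t - τ 0) ?_ hψ
    simpa using hF₂
  have hPA : AnalyticAt ℝ (fun t => ∑ M ∈ Finset.range (N + 1), c M * y t ^ M) 0 :=
    Finset.analyticAt_fun_sum _ fun M _ => analyticAt_const.mul (hyA.pow M)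
  have key : (fun t => f (τ t)) =ᶠ[𝓝 0] fun t =>
      (∑ M ∈ Finset.range (N + 1), c M * y t ^ M) + t ^ (N + 1) * g t := by
    filter_upwards [eψ, eψ₁, eψ₂] with t h1 h2 h3
    rw [add_sub_cancel] at h3
    rw [h3]
    have e1 : ∀ M, (τ t - τ 0) ^ M = y t ^ M + t ^ (N + 1) * (F t *
        ∑ i ∈ Finset.range M, (τ t - τ 0) ^ i * y t ^ (M - 1 - i)) := fun M => by
      have := geom_sum₂_mul (τ t - τ 0) (y t) M
      rw [← sub_eq_iff_eq_add', ← this, h1]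
      ring
    have e2 : ∀ M ∈ Finset.range (N + 1), ((τ t - τ 0) ^ M / (M ! : ℝ)) •
        iteratedDeriv M (fun z => f (τ 0 + z)) 0 = c M * y t ^ M + t ^ (N + 1) * (c M * (F t *
        ∑ i ∈ Finset.range M, (τ t - τ 0) ^ i * y t ^ (M - 1 - i))) := fun M _ => by
      rw [e1 M, iteratedDeriv_comp_const_add]
      simp only [hc, smul_eq_mul, add_zero]
      ring
    have e3 : (τ t - τ 0) ^ (N + 1) = t ^ (N + 1) * F₁ t ^ (N + 1) := by rw [h2, mul_pow]
    rw [Finset.sum_congr rfl e2, Finset.sum_add_distrib, ← Finset.mul_sum, smul_eq_mul, e3, hg]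
    ring
  have hm : AnalyticAt ℝ (fun t => t ^ (N + 1) * g t) 0 := (analyticAt_id.pow _).mul hgA
  rw [key.iteratedDeriv_eq, iteratedDeriv_fun_add hPA.contDiffAt hm.contDiffAt,
    iteratedDeriv_pow_succ_mul hgA N, add_zero]

/-- The multinomial theorem expands the powers of the Taylor polynomial of `τ`; the derivative of
order `N` at `0` keeps just the monomials $t^N$, i.e. the tuples of weight `N`. -/
theorem iteratedDeriv_comp_eq_sum_bruno {f τ : ℝ → ℝ} (hτ : AnalyticAt ℝ τ 0)
    (hf : AnalyticAt ℝ f (τ 0)) (N : ℕ) :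
    iteratedDeriv N (fun t => f (τ t)) 0 = ∑ m ∈ bruno N,
      brunoCoeff m * iteratedDeriv (∑ i, m i) f (τ 0) *
        ∏ i : Fin N, iteratedDeriv ((i : ℕ) + 1) τ 0 ^ m i := by
  rw [iteratedDeriv_comp_eq_of_taylor hτ hf]
  simp only [Finset.sum_pow_eq_sum_piAntidiag, Finset.mul_sum]
  rw [iteratedDeriv_fun_sum fun M _ => ?_]
  swap
  · exact ContDiffAt.sum fun m _ => by fun_prop
  have hmaps : ∀ m ∈ bruno N, ∑ i, m i ∈ Finset.range (N + 1) := fun m hm => by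
    rw [bruno, Finset.mem_filter] at hm
    rw [Finset.mem_range, Nat.lt_succ_iff]
    refine le_trans (Finset.sum_le_sum fun i _ => ?_) hm.2.le
    exact Nat.le_mul_of_pos_left _ (Nat.succ_pos _)
  rw [← Finset.sum_fiberwise_of_maps_to hmaps]
  refine Finset.sum_congr rfl fun M _ => ?_
  rw [iteratedDeriv_fun_sum fun m _ => by fun_prop]
  -- The bound on the entries in `bruno` is implied by the weight equation.
  have hset : (bruno N).filter (fun m => ∑ i, m i = M) =
      ((Finset.univ : Finset (Fin N)).piAntidiag M).filter
        (fun m => ∑ i : Fin N, ((i : ℕ) + 1) * m i = N) := by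
    ext m
    simp only [bruno, Finset.mem_filter, Fintype.mem_piFinset, Finset.mem_range,
      Finset.mem_piAntidiag, Finset.mem_univ, implies_true, and_true]
    constructor
    · rintro ⟨⟨-, h2⟩, h3⟩
      exact ⟨h3, h2⟩
    · rintro ⟨h3, h2⟩
      refine ⟨⟨fun i => ?_, h2⟩, h3⟩
      rw [Nat.lt_succ_iff, ← h2]
      exact (Nat.le_mul_of_pos_left _ (Nat.succ_pos _)).trans
        (Finset.single_le_sum (f := fun i : Fin N => ((i : ℕ) + 1) * m i)
          (fun _ _ => Nat.zero_le _) (Finset.mem_univ i))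
  rw [hset, Finset.sum_filter]
  refine Finset.sum_congr rfl fun m hm => ?_
  have hM : ∑ i, m i = M := (Finset.mem_piAntidiag.1 hm).1
  have hprod : ∀ t : ℝ, iteratedDeriv M f (τ 0) / (M ! : ℝ) *
      ((Nat.multinomial Finset.univ m : ℝ) * ∏ i : Fin N, (iteratedDeriv ((i : ℕ) + 1) τ 0 /
        (((i : ℕ) + 1)! : ℝ) * t ^ ((i : ℕ) + 1)) ^ m i) =
      (iteratedDeriv M f (τ 0) / (M ! : ℝ) * ((Nat.multinomial Finset.univ m : ℝ) *
        ∏ i : Fin N, (iteratedDeriv ((i : ℕ) + 1) τ 0 / (((i : ℕ) + 1)! : ℝ)) ^ m i)) *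
        t ^ (∑ i : Fin N, ((i : ℕ) + 1) * m i) := fun t => by
    simp only [mul_pow, Finset.prod_mul_distrib, ← pow_mul, Finset.prod_pow_eq_pow_sum]
    ring
  simp only [hprod]
  rw [iteratedDeriv_const_mul _ (by fun_prop), iteratedDeriv_fun_pow_zero]
  by_cases hN : ∑ i : Fin N, ((i : ℕ) + 1) * m i = N
  · rw [if_pos hN.symm, if_pos hN, hN, hM, brunoCoeff]
    have hspec := congrArg (fun i : ℕ => (i : ℝ)) (Nat.multinomial_spec Finset.univ m)
    rw [hM] at hspec
    push_cast at hspec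
    have hM0 : (M ! : ℝ) ≠ 0 := by positivity
    have hp : (∏ i : Fin N, ((m i)! : ℝ)) ≠ 0 := Finset.prod_ne_zero_iff.2 fun i _ => by positivity
    have hq : (∏ i : Fin N, ((((i : ℕ) + 1)! : ℝ) ^ m i)) ≠ 0 :=
      Finset.prod_ne_zero_iff.2 fun i _ => by positivity
    simp only [div_pow, Finset.prod_div_distrib, Finset.prod_mul_distrib]
    rw [← hspec] at hM0 ⊢
    have hmn := right_ne_zero_of_mul hM0
    field_simp
  · rw [if_neg (Ne.symm hN), if_neg hN]
    simp

end BEC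

end

noncomputable section

namespace BEC

open scoped BoundedContinuousFunction ContDiff

/-! ### The critical points of the rate -/

/-- The sequence of the entropies of the chain with parameter `θ ∈ (0, 1)`. -/
def entropySeq : ℝ → ℕ →ᵇ ℝ := exists_analytic_entropies.choose

lemma analyticOnNhd_entropySeq : AnalyticOnNhd ℝ entropySeq (Ioo 0 1) :=
  exists_analytic_entropies.choose_spec.1

lemma entropySeq_apply {θ : ℝ} (hθ : θ ∈ Ioo (0 : ℝ) 1) (k : ℕ) :
    entropySeq θ k = rllCondEntropy k θ :=
  exists_analytic_entropies.choose_spec.2 θ hθ k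

lemma hasDerivAt_seq_apply {K : ℝ → ℕ →ᵇ ℝ} {t : ℝ} (hK : AnalyticAt ℝ K t) (k : ℕ) :
    HasDerivAt (fun s => K s k) (deriv K t k) t :=
  (BoundedContinuousFunction.evalCLM ℝ k : (ℕ →ᵇ ℝ) →L[ℝ] ℝ).hasFDerivAt.comp_hasDerivAt t
    hK.differentiableAt.hasDerivAt

lemma analyticAt_rllCondEntropy {θ : ℝ} (hθ : θ ∈ Ioo (0 : ℝ) 1) (k : ℕ) :
    AnalyticAt ℝ (rllCondEntropy k) θ := by
  refine (analyticAt_seq_apply (analyticOnNhd_entropySeq θ hθ) k).congr ?_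
  filter_upwards [isOpen_Ioo.mem_nhds hθ] with t ht using entropySeq_apply ht k

lemma deriv_entropySeq_apply {θ : ℝ} (hθ : θ ∈ Ioo (0 : ℝ) 1) (k : ℕ) :
    deriv entropySeq θ k = deriv (rllCondEntropy k) θ := by
  have h : (fun s => entropySeq s k) =ᶠ[𝓝 θ] rllCondEntropy k := by
    filter_upwards [isOpen_Ioo.mem_nhds hθ] with t ht using entropySeq_apply ht k
  rw [← h.deriv_eq]
  exact (hasDerivAt_seq_apply (analyticOnNhd_entropySeq θ hθ) k).deriv.symm

lemma deriv_entropySeq_apply_eq_slope {θ : ℝ} (hθ : θ ∈ Ioo (0 : ℝ) 1) (k : ℕ) :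
    (1 + θ) ^ 2 * deriv entropySeq θ k = rllSlope k θ := by
  have : 0 < 1 + θ := by linarith [hθ.1]
  rw [deriv_entropySeq_apply hθ, (hasDerivAt_rllCondEntropy hθ k).deriv]
  field_simp

/-- The derivative with respect to `θ` of the normalized rate. -/
def critFun (ε θ : ℝ) : ℝ := geomEval ε (deriv entropySeq θ)

lemma mem_ball_of_mem_Ico {ε : ℝ} (hε : ε ∈ Ico (0 : ℝ) 1) : ε ∈ Metric.ball (0 : ℝ) 1 := by
  simpa [abs_of_nonneg hε.1] using hε.2

lemma hasSum_rllSlope {ε θ : ℝ} (hε : ε ∈ Ico (0 : ℝ) 1) (hθ : θ ∈ Ioo (0 : ℝ) 1) :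
    HasSum (fun k => ε ^ k * rllSlope k θ) ((1 + θ) ^ 2 * critFun ε θ) := by
  have := (hasSum_geomEval (mem_ball_of_mem_Ico hε) (deriv entropySeq θ)).mul_left ((1 + θ) ^ 2)
  simp only [mul_left_comm ((1 + θ) ^ 2), deriv_entropySeq_apply_eq_slope hθ] at this
  exact this

lemma antitoneOn_rllSlope (k : ℕ) : AntitoneOn (rllSlope k) (Ioo 0 1) := by
  have hd : ∀ t ∈ Ioo (0 : ℝ) 1, DifferentiableAt ℝ (rllSlope k) t := fun t ht => by
    obtain ⟨c, _, hc, _⟩ := exists_hasDerivAt_rllSlope ht k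
    exact hc.differentiableAt
  refine antitoneOn_of_deriv_nonpos (convex_Ioo 0 1)
    (fun t ht => (hd t ht).continuousAt.continuousWithinAt)
    (fun t ht => (hd t (interior_subset ht)).differentiableWithinAt) fun t ht => ?_
  obtain ⟨c, h0, hc, _⟩ := exists_hasDerivAt_rllSlope (interior_subset ht) k
  rwa [hc.deriv]

lemma strictAntiOn_rllSlope_zero : StrictAntiOn (rllSlope 0) (Ioo 0 1) := by
  have hd : ∀ t ∈ Ioo (0 : ℝ) 1, DifferentiableAt ℝ (rllSlope 0) t := fun t ht => by
    obtain ⟨c, _, hc, _⟩ := exists_hasDerivAt_rllSlope ht 0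
    exact hc.differentiableAt
  refine strictAntiOn_of_deriv_neg (convex_Ioo 0 1)
    (fun t ht => (hd t ht).continuousAt.continuousWithinAt) fun t ht => ?_
  obtain ⟨c, _, hc, h0⟩ := exists_hasDerivAt_rllSlope (interior_subset ht) 0
  rw [hc.deriv]
  exact h0 rfl

/-- The factor $(1+\theta)^2$ turns the derivative in $\theta$ into the one in $\theta/(1+\theta)$,
in which all entropies are concave. Without it monotonicity is not claimed. -/
lemma critFun_strictAnti {ε s t : ℝ} (hε : ε ∈ Ico (0 : ℝ) 1) (hs : s ∈ Ioo (0 : ℝ) 1)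
    (ht : t ∈ Ioo (0 : ℝ) 1) (hst : s < t) :
    (1 + t) ^ 2 * critFun ε t < (1 + s) ^ 2 * critFun ε s :=
  hasSum_lt (i := 0) (fun k => mul_le_mul_of_nonneg_left (antitoneOn_rllSlope k hs ht hst.le)
    (pow_nonneg hε.1 k)) (by simpa using strictAntiOn_rllSlope_zero hs ht hst)
    (hasSum_rllSlope hε ht) (hasSum_rllSlope hε hs)

lemma critFun_neg_of_lt {ε θ t : ℝ} (hε : ε ∈ Ico (0 : ℝ) 1) (hθ : θ ∈ Ioo (0 : ℝ) 1)
    (h0 : critFun ε θ = 0) (ht : t ∈ Ioo (0 : ℝ) 1) (hlt : θ < t) : critFun ε t < 0 := by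
  have h := critFun_strictAnti hε hθ ht hlt
  rw [h0, mul_zero] at h
  exact neg_of_mul_neg_right h (sq_nonneg _)

lemma critFun_pos_of_lt {ε θ t : ℝ} (hε : ε ∈ Ico (0 : ℝ) 1) (hθ : θ ∈ Ioo (0 : ℝ) 1)
    (h0 : critFun ε θ = 0) (ht : t ∈ Ioo (0 : ℝ) 1) (hlt : t < θ) : 0 < critFun ε t := by
  have h := critFun_strictAnti hε ht hθ hlt
  rw [h0, mul_zero] at h
  exact pos_of_mul_pos_right h (sq_nonneg _)

lemma critFun_unique {ε θ t : ℝ} (hε : ε ∈ Ico (0 : ℝ) 1) (hθ : θ ∈ Ioo (0 : ℝ) 1)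
    (h0 : critFun ε θ = 0) (ht : t ∈ Ioo (0 : ℝ) 1) (ht0 : critFun ε t = 0) : t = θ := by
  rcases lt_trichotomy t θ with h | h | h
  · exact absurd ht0 (critFun_pos_of_lt hε hθ h0 ht h).ne'
  · exact h
  · exact absurd ht0 (critFun_neg_of_lt hε hθ h0 ht h).ne

/-! ### Existence and uniqueness of the maximizer -/

/-- The rate without the factor `(1 - ε) ^ 2`. -/
def rateSum (ε θ : ℝ) : ℝ := ∑' k, ε ^ k * rllCondEntropy k θ

lemma rateSum_eq_geomEval {ε θ : ℝ} (hε : ε ∈ Ico (0 : ℝ) 1) (hθ : θ ∈ Ioo (0 : ℝ) 1) :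
    rateSum ε θ = geomEval ε (entropySeq θ) := by
  simp only [rateSum, ← entropySeq_apply hθ]
  exact (hasSum_geomEval (mem_ball_of_mem_Ico hε) _).tsum_eq

lemma hasDerivAt_rateSum {ε θ : ℝ} (hε : ε ∈ Ico (0 : ℝ) 1) (hθ : θ ∈ Ioo (0 : ℝ) 1) :
    HasDerivAt (rateSum ε) (critFun ε θ) θ := by
  have h : rateSum ε =ᶠ[𝓝 θ] fun t => geomEval ε (entropySeq t) := by
    filter_upwards [isOpen_Ioo.mem_nhds hθ] with t ht using rateSum_eq_geomEval hε ht
  rw [h.hasDerivAt_iff]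
  exact (geomEval ε).hasFDerivAt.comp_hasDerivAt θ
    (analyticOnNhd_entropySeq θ hθ).differentiableAt.hasDerivAt

lemma continuousOn_rateSum {ε : ℝ} (hε : ε ∈ Ico (0 : ℝ) 1) :
    ContinuousOn (rateSum ε) (Icc 0 1) := by
  refine continuousOn_tsum (u := fun k => ε ^ k)
    (fun k => continuousOn_const.mul (continuousOn_rllCondEntropy k))
    (summable_geometric_of_lt_one hε.1 hε.2) fun k θ hθ => ?_
  rw [Real.norm_eq_abs, abs_of_nonneg (mul_nonneg (pow_nonneg hε.1 k) (rllCondEntropy_nonneg hθ k))]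
  exact mul_le_of_le_one_right (pow_nonneg hε.1 k) (rllCondEntropy_le hθ k)

lemma rateSum_half_pos {ε : ℝ} (hε : ε ∈ Ico (0 : ℝ) 1) : 0 < rateSum ε (1 / 2) := by
  have hI : (1 / 2 : ℝ) ∈ Ioo (0 : ℝ) 1 := by norm_num
  have hI' := Ioo_subset_Icc_self hI
  have h0 : 0 < rllCondEntropy 0 (1 / 2) := by
    rw [rllCondEntropy_eq hI']
    have : 0 < Real.log 2 := Real.log_pos (by norm_num)
    norm_num [Real.negMulLog]
    rw [show (1 / 2 : ℝ) = 2⁻¹ by norm_num, Real.log_inv]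
    linarith
  refine Summable.tsum_pos ?_ (fun k => mul_nonneg (pow_nonneg hε.1 k)
    (rllCondEntropy_nonneg hI' k)) 0 (by simpa using h0)
  have := (hasSum_geomEval (mem_ball_of_mem_Ico hε) (entropySeq (1 / 2))).summable
  simpa only [entropySeq_apply hI] using this

/-- A maximizer on $[0,1]$ exists by compactness and is interior, since the rate vanishes at both
ends and is positive at $1/2$. -/
lemma exists_critFun_eq_zero {ε : ℝ} (hε : ε ∈ Ico (0 : ℝ) 1) :
    ∃ θ ∈ Ioo (0 : ℝ) 1, critFun ε θ = 0 := by
  obtain ⟨θ, hθ, hmax⟩ := isCompact_Icc.exists_isMaxOn (nonempty_Icc.2 zero_le_one)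
    (continuousOn_rateSum hε)
  have hpos : 0 < rateSum ε θ :=
    (rateSum_half_pos hε).trans_le (hmax (show (1 / 2 : ℝ) ∈ Icc (0 : ℝ) 1 by norm_num))
  have h0 : θ ≠ 0 := by
    rintro rfl
    simp [rateSum, rllCondEntropy_zero] at hpos
  have h1 : θ ≠ 1 := by
    rintro rfl
    simp [rateSum, rllCondEntropy_one] at hpos
  have hI : θ ∈ Ioo (0 : ℝ) 1 := ⟨hθ.1.lt_of_ne' h0, hθ.2.lt_of_ne h1⟩
  exact ⟨θ, hI, (hmax.isLocalMax (Icc_mem_nhds hI.1 hI.2)).hasDerivAt_eq_zero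
    (hasDerivAt_rateSum hε hI)⟩

open Classical in
/-- The optimal parameter. -/
def optimalParam (ε : ℝ) : ℝ :=
  if h : ε ∈ Ico (0 : ℝ) 1 then (exists_critFun_eq_zero h).choose else 0

lemma optimalParam_mem {ε : ℝ} (hε : ε ∈ Ico (0 : ℝ) 1) : optimalParam ε ∈ Ioo (0 : ℝ) 1 := by
  rw [optimalParam, dif_pos hε]
  exact (exists_critFun_eq_zero hε).choose_spec.1

lemma critFun_optimalParam {ε : ℝ} (hε : ε ∈ Ico (0 : ℝ) 1) : critFun ε (optimalParam ε) = 0 := by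
  rw [optimalParam, dif_pos hε]
  exact (exists_critFun_eq_zero hε).choose_spec.2

lemma optimalParam_eq {ε θ : ℝ} (hε : ε ∈ Ico (0 : ℝ) 1) (hθ : θ ∈ Ioo (0 : ℝ) 1)
    (h0 : critFun ε θ = 0) :
    optimalParam ε = θ :=
  critFun_unique hε hθ h0 (optimalParam_mem hε) (critFun_optimalParam hε)

lemma rateSum_lt_optimalParam {ε s : ℝ} (hε : ε ∈ Ico (0 : ℝ) 1) (hs : s ∈ Icc (0 : ℝ) 1)
    (hne : s ≠ optimalParam ε) :
    rateSum ε s < rateSum ε (optimalParam ε) := by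
  have hθ := optimalParam_mem hε
  have h0 := critFun_optimalParam hε
  have hcont := continuousOn_rateSum hε
  rcases lt_or_gt_of_ne hne with h | h
  · refine strictMonoOn_of_deriv_pos (convex_Icc 0 (optimalParam ε))
      (hcont.mono (Icc_subset_Icc_right hθ.2.le)) (fun t ht => ?_) ⟨hs.1, h.le⟩
      (right_mem_Icc.2 hθ.1.le) h
    rw [interior_Icc] at ht
    have ht' : t ∈ Ioo (0 : ℝ) 1 := ⟨ht.1, ht.2.trans hθ.2⟩
    rw [(hasDerivAt_rateSum hε ht').deriv]
    exact critFun_pos_of_lt hε hθ h0 ht' ht.2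
  · refine strictAntiOn_of_deriv_neg (convex_Icc (optimalParam ε) 1)
      (hcont.mono (Icc_subset_Icc_left hθ.1.le)) (fun t ht => ?_)
      (left_mem_Icc.2 hθ.2.le) ⟨h.le, hs.2⟩ h
    rw [interior_Icc] at ht
    have ht' : t ∈ Ioo (0 : ℝ) 1 := ⟨hθ.1.trans ht.1, ht.2⟩
    rw [(hasDerivAt_rateSum hε ht').deriv]
    exact critFun_neg_of_lt hε hθ h0 ht' ht.1

lemma isOptimalParam_optimalParam {ε : ℝ} (hε : ε ∈ Ico (0 : ℝ) 1) :
    IsOptimalParam ε (optimalParam ε) := by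
  have hθ := Ioo_subset_Icc_self (optimalParam_mem hε)
  refine ⟨hθ, fun s hs hne => ?_⟩
  rw [rllRate_eq hε hs, rllRate_eq hε hθ]
  have : 0 < 1 - ε := sub_pos.2 hε.2
  exact mul_lt_mul_of_pos_left (rateSum_lt_optimalParam hε hs hne) (by positivity)

lemma isGreatest_markovRates {ε : ℝ} (hε : ε ∈ Ico (0 : ℝ) 1) :
    IsGreatest (markovRates ε) (rllRate ε (optimalParam ε)) := by
  have h := isOptimalParam_optimalParam hε
  rw [markovRates_eq]
  refine ⟨mem_image_of_mem _ h.1, ?_⟩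
  rintro _ ⟨s, hs, rfl⟩
  rcases eq_or_ne s (optimalParam ε) with rfl | hne
  · exact le_rfl
  · exact (h.2 s hs hne).le

lemma markovCapacity_eq {ε : ℝ} (hε : ε ∈ Ico (0 : ℝ) 1) :
    markovCapacity ε = rllRate ε (optimalParam ε) :=
  (isGreatest_markovRates hε).csSup_eq

lemma isLUB_markovCapacity {ε : ℝ} (hε : ε ∈ Ico (0 : ℝ) 1) :
    IsLUB (markovRates ε) (markovCapacity ε) := by
  rw [markovCapacity_eq hε]
  exact (isGreatest_markovRates hε).isLUB

lemma markovCapacity_eq_geomEval {ε : ℝ} (hε : ε ∈ Ico (0 : ℝ) 1) :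
    markovCapacity ε = (1 - ε) ^ 2 * geomEval ε (entropySeq (optimalParam ε)) := by
  have hθ := optimalParam_mem hε
  rw [markovCapacity_eq hε, rllRate_eq hε (Ioo_subset_Icc_self hθ), ← rateSum_eq_geomEval hε hθ,
    rateSum]

/-- Nondegeneracy of the critical point: differentiating $(1+\theta)^2$ times `critFun` gives a
negative number, and the term with the derivative of $(1+\theta)^2$ drops out where `critFun`
vanishes. -/
lemma geomEval_deriv2_neg {ε : ℝ} (hε : ε ∈ Ico (0 : ℝ) 1) :
    geomEval ε (deriv (deriv entropySeq) (optimalParam ε)) < 0 := by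
  set θ := optimalParam ε
  have hθ : θ ∈ Ioo (0 : ℝ) 1 := optimalParam_mem hε
  have hs : 0 < 1 + θ := by linarith [hθ.1]
  have h0 : geomEval ε (deriv entropySeq θ) = 0 := critFun_optimalParam hε
  set x : ℕ →ᵇ ℝ := (2 * (1 + θ)) • deriv entropySeq θ + (1 + θ) ^ 2 • deriv (deriv entropySeq) θ
  have hx : ∀ k, HasDerivAt (rllSlope k) (x k) θ := fun k => by
    have hd := hasDerivAt_seq_apply (analyticOnNhd_entropySeq θ hθ).deriv k
    have hev : rllSlope k =ᶠ[𝓝 θ] fun t => (1 + t) ^ 2 * deriv entropySeq t k := by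
      filter_upwards [isOpen_Ioo.mem_nhds hθ] with t ht
        using (deriv_entropySeq_apply_eq_slope ht k).symm
    rw [hev.hasDerivAt_iff]
    refine ((((hasDerivAt_id' θ).const_add 1).fun_pow 2).fun_mul hd).congr_deriv ?_
    simp [x]
  have hk : ∀ k, x k ≤ 0 ∧ (k = 0 → x k < 0) := fun k => by
    obtain ⟨c, hc0, hc, hc1⟩ := exists_hasDerivAt_rllSlope hθ k
    rw [(hx k).unique hc]
    exact ⟨hc0, hc1⟩
  have hlt : geomEval ε x < 0 :=
    hasSum_lt (i := 0) (fun k => mul_nonpos_of_nonneg_of_nonpos (pow_nonneg hε.1 k) (hk k).1)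
      (by simpa using (hk 0).2 rfl) (hasSum_geomEval (mem_ball_of_mem_Ico hε) x) hasSum_zero
  simp only [x, map_add, map_smul, h0, mul_zero, zero_add, smul_eq_mul] at hlt
  exact neg_of_mul_neg_right hlt (sq_nonneg _)

/-- The optimal parameter is locally the restriction of an analytic function. -/
theorem exists_analytic_optimalParam {ε : ℝ} (hε : ε ∈ Ico (0 : ℝ) 1) :
    ∃ τ : ℝ → ℝ, AnalyticAt ℝ τ ε ∧ τ ε = optimalParam ε ∧
    (∀ᶠ t in 𝓝 ε, τ t ∈ Ioo (0 : ℝ) 1 ∧ critFun t (τ t) = 0) ∧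
    optimalParam =ᶠ[𝓝[Ico 0 1] ε] τ := by
  set θ := optimalParam ε with hθdef
  have hθ : θ ∈ Ioo (0 : ℝ) 1 := optimalParam_mem hε
  set f : ℝ × ℝ → ℝ := fun z => critFun z.1 z.2
  have hd := (analyticOnNhd_entropySeq θ hθ).deriv
  have hf : AnalyticAt ℝ f (ε, θ) := by
    have h1 : AnalyticAt ℝ (fun z : ℝ × ℝ => geomEval z.1) (ε, θ) :=
      AnalyticAt.comp (g := geomEval) (f := Prod.fst)
        (analyticOnNhd_geomEval ε (mem_ball_of_mem_Ico hε)) analyticAt_fst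
    have h2 : AnalyticAt ℝ (fun z : ℝ × ℝ => deriv entropySeq z.2) (ε, θ) :=
      AnalyticAt.comp (g := deriv entropySeq) (f := Prod.snd) hd analyticAt_snd
    exact (ContinuousLinearMap.analyticAt_bilinear
      (ContinuousLinearMap.id ℝ ((ℕ →ᵇ ℝ) →L[ℝ] ℝ)) (geomEval ε, deriv entropySeq θ)).comp₂ h1 h2
  have hcd : ContDiffAt ℝ ω f (ε, θ) := hf.contDiffAt
  have hder : (fderiv ℝ f (ε, θ)) (0, 1) = geomEval ε (deriv (deriv entropySeq) θ) := by
    have h1 : HasDerivAt (fun t : ℝ => ((ε, t) : ℝ × ℝ)) (0, 1) θ :=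
      (hasDerivAt_const θ ε).prodMk (hasDerivAt_id' θ)
    have h2 : HasDerivAt (fun t => f (ε, t)) (fderiv ℝ f (ε, θ) (0, 1)) θ :=
      hf.differentiableAt.hasFDerivAt.comp_hasDerivAt θ h1
    have h3 : HasDerivAt (fun t => f (ε, t)) (geomEval ε (deriv (deriv entropySeq) θ)) θ :=
      (geomEval ε).hasFDerivAt.comp_hasDerivAt θ hd.differentiableAt.hasDerivAt
    exact h2.unique h3
  have hne : geomEval ε (deriv (deriv entropySeq) θ) ≠ 0 := (geomEval_deriv2_neg hε).ne
  have hinv : (fderiv ℝ f (ε, θ) ∘L .inr ℝ ℝ ℝ).IsInvertible := by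
    refine ⟨ContinuousLinearEquiv.unitsEquivAut ℝ (Units.mk0 _ hne), ?_⟩
    ext
    simp [hder]
  refine ⟨hcd.implicitFunction (by simp) hinv, (hcd.contDiffAt_implicitFunction _ hinv).analyticAt,
    hcd.implicitFunction_apply_self _ hinv, ?_⟩
  set τ := hcd.implicitFunction (by simp) hinv
  have hτε : τ ε = θ := hcd.implicitFunction_apply_self (by simp) hinv
  have hev : ∀ᶠ t in 𝓝 ε, τ t ∈ Ioo (0 : ℝ) 1 ∧ critFun t (τ t) = 0 := by
    have hcont : ContinuousAt τ ε :=
      (hcd.contDiffAt_implicitFunction (by simp) hinv).continuousAt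
    have h1 : ∀ᶠ t in 𝓝 ε, τ t ∈ Ioo (0 : ℝ) 1 :=
      hcont.eventually_mem (isOpen_Ioo.mem_nhds (by rwa [hτε]))
    filter_upwards [h1, hcd.eventually_apply_implicitFunction (by simp) hinv] with t ht1 ht2
    exact ⟨ht1, ht2.trans (critFun_optimalParam hε)⟩
  refine ⟨hev, ?_⟩
  -- Uniqueness of the critical point identifies `τ` with the chosen parameter, but only on $[0,1)$;
  -- `τ` itself also lives to the left of $0$.
  filter_upwards [nhdsWithin_le_nhds hev, self_mem_nhdsWithin] with t ht1 ht2
  exact optimalParam_eq ht2 ht1.1 ht1.2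

end BEC

end

noncomputable section

namespace BEC

open scoped BoundedContinuousFunction ContDiff

/-! ### Expansion at zero -/

lemma zero_mem_Ico : (0 : ℝ) ∈ Ico (0 : ℝ) 1 := by simp

lemma geomEval_zero (x : ℕ →ᵇ ℝ) : geomEval 0 x = x 0 := by
  rw [geomEval_eq_add zero_mem_unit_ball, zero_mul, add_zero]

lemma inv_sq_goldenRatio_mem : 1 / Real.goldenRatio ^ 2 ∈ Ioo (0 : ℝ) 1 := by
  have h1 := Real.one_lt_goldenRatio
  refine ⟨by positivity, ?_⟩
  rw [div_lt_one (by positivity)]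
  exact one_lt_pow₀ h1 two_ne_zero

/-- The critical equation of $H_0$ is $(1-\theta)^2=\theta$. -/
lemma optimalParam_zero : optimalParam 0 = 1 / Real.goldenRatio ^ 2 := by
  have hI := inv_sq_goldenRatio_mem
  refine optimalParam_eq zero_mem_Ico hI ?_
  rw [critFun, geomEval_zero, deriv_entropySeq_apply hI, (hasDerivAt_rllCondEntropy hI 0).deriv,
    rllSlope_zero hI]
  have hg := Real.goldenRatio_pos
  have h1 : 1 - 1 / Real.goldenRatio ^ 2 = Real.goldenRatio⁻¹ := by
    have aux : ∀ g : ℝ, 0 < g → g ^ 2 = g + 1 → 1 - 1 / g ^ 2 = g⁻¹ := by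
      intro g hg hsq
      rw [sub_eq_iff_eq_add]
      field_simp
      linarith
    exact aux _ hg Real.goldenRatio_sq
  rw [h1, Real.log_inv, one_div, Real.log_inv, Real.log_pow]
  push_cast
  ring

lemma deriv_deriv_entropySeq_apply {θ : ℝ} (hθ : θ ∈ Ioo (0 : ℝ) 1) (k : ℕ) :
    deriv (deriv entropySeq) θ k = iteratedDeriv 2 (rllCondEntropy k) θ := by
  have h : (fun s => deriv entropySeq s k) =ᶠ[𝓝 θ] deriv (rllCondEntropy k) := by
    filter_upwards [isOpen_Ioo.mem_nhds hθ] with t ht using deriv_entropySeq_apply ht k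
  rw [iteratedDeriv_succ, iteratedDeriv_one, ← h.deriv_eq]
  exact (hasDerivAt_seq_apply (analyticOnNhd_entropySeq θ hθ).deriv k).deriv.symm

lemma iteratedDeriv_two_rllCondEntropy_ne_zero :
    iteratedDeriv 2 (rllCondEntropy 0) (1 / Real.goldenRatio ^ 2) ≠ 0 := by
  have h := geomEval_deriv2_neg zero_mem_Ico
  rw [geomEval_zero, optimalParam_zero, deriv_deriv_entropySeq_apply inv_sq_goldenRatio_mem] at h
  exact h.ne

lemma analyticWithinAt_of_eventuallyEq {f g : ℝ → ℝ} {s : Set ℝ} {x : ℝ} (hx : x ∈ s)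
    (h : f =ᶠ[𝓝[s] x] g) (hg : AnalyticAt ℝ g x) : AnalyticWithinAt ℝ f s x :=
  hg.analyticWithinAt.congr_of_eventuallyEq h (h.eq_of_nhdsWithin hx)

/-- This replaces one-sided derivatives by ordinary derivatives of an analytic extension. -/
lemma derivAtZero_eq {f g : ℝ → ℝ} (h : f =ᶠ[𝓝[Ico 0 1] 0] g) (hg : AnalyticAt ℝ g 0) (n : ℕ) :
    derivAtZero f n = iteratedDeriv n g 0 := by
  rw [derivAtZero, h.iteratedDerivWithin_eq (h.eq_of_nhdsWithin zero_mem_Ico),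
    iteratedDerivWithin_eq_iteratedDeriv (uniqueDiffOn_Ico 0 1) hg.contDiffAt zero_mem_Ico]

theorem analyticOn_optimalParam : AnalyticOn ℝ optimalParam (Ico 0 1) := fun ε hε => by
  obtain ⟨τ, hτ, -, -, heq⟩ := exists_analytic_optimalParam hε
  exact analyticWithinAt_of_eventuallyEq hε heq hτ

theorem analyticOn_entropyAlong (k : ℕ) : AnalyticOn ℝ (entropyAlong optimalParam k) (Ico 0 1) :=
  fun ε hε => by
    obtain ⟨τ, hτ, hτε, -, heq⟩ := exists_analytic_optimalParam hε
    refine analyticWithinAt_of_eventuallyEq (g := fun t => rllCondEntropy k (τ t)) hε ?_ ?_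
    · filter_upwards [heq] with t ht
      rw [entropyAlong, ht]
    · refine AnalyticAt.fun_comp (g := rllCondEntropy k) ?_ hτ
      rw [hτε]
      exact analyticAt_rllCondEntropy (optimalParam_mem hε) k

lemma analyticAt_entropySeq_comp {τ : ℝ → ℝ} {ε : ℝ} (hτ : AnalyticAt ℝ τ ε)
    (h : τ ε ∈ Ioo (0 : ℝ) 1) : AnalyticAt ℝ (fun t => entropySeq (τ t)) ε :=
  AnalyticAt.fun_comp (analyticOnNhd_entropySeq _ h) hτ

theorem analyticOn_markovCapacity : AnalyticOn ℝ markovCapacity (Ico 0 1) := fun ε hε => by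
  obtain ⟨τ, hτ, hτε, -, heq⟩ := exists_analytic_optimalParam hε
  refine analyticWithinAt_of_eventuallyEq
    (g := fun t => (1 - t) ^ 2 * geomEval t (entropySeq (τ t))) hε ?_ ?_
  · filter_upwards [heq, self_mem_nhdsWithin] with t ht hI
    rw [markovCapacity_eq_geomEval hI, ht]
  · refine AnalyticAt.fun_mul (by fun_prop) (analyticAt_geomEval_apply (mem_ball_of_mem_Ico hε)
      (analyticAt_entropySeq_comp hτ ?_))
    rw [hτε]
    exact optimalParam_mem hε

/-! #### The derivatives of the optimal parameter -/

/-- A nonzero last entry uses up the whole weight. The one tuple left carries the derivative of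
$\theta_{\max}$ of highest order, for which the recursion is solved. -/
lemma bruno_filter_not (N : ℕ) :
    (bruno (N + 1)).filter (fun m => ¬ ∀ i : Fin (N + 1), (i : ℕ) + 1 = N + 1 → m i = 0) =
      {Pi.single (Fin.last N) 1} := by
  ext m
  have hlast : (∀ i : Fin (N + 1), (i : ℕ) + 1 = N + 1 → m i = 0) ↔ m (Fin.last N) = 0 := by
    constructor
    · exact fun h => h _ (by simp)
    · intro h i hi
      rwa [show i = Fin.last N from Fin.ext (by simpa using hi)]
  rw [Finset.mem_filter, hlast, Finset.mem_singleton, bruno, Finset.mem_filter,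
    Fintype.mem_piFinset]
  constructor
  · rintro ⟨⟨-, hsum⟩, hne⟩
    rw [Fin.sum_univ_castSucc] at hsum
    simp only [Fin.val_castSucc, Fin.val_last] at hsum
    have h1 : m (Fin.last N) = 1 := by
      have h2 : (N + 1) * m (Fin.last N) ≤ (N + 1) * 1 :=
        (Nat.le_add_left _ _).trans (hsum.le.trans_eq (mul_one _).symm)
      exact le_antisymm (Nat.le_of_mul_le_mul_left h2 N.succ_pos) (Nat.one_le_iff_ne_zero.2 hne)
    rw [h1, mul_one, Nat.add_eq_right, Finset.sum_eq_zero_iff] at hsum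
    funext i
    refine Fin.lastCases ?_ (fun j => ?_) i
    · simp [h1]
    · have := hsum j (Finset.mem_univ j)
      rw [Pi.single_eq_of_ne (Fin.castSucc_lt_last j).ne]
      simpa using this
  · rintro rfl
    refine ⟨⟨fun i => ?_, ?_⟩, by simp⟩
    · rw [Finset.mem_range]
      by_cases h : i = Fin.last N
      · simp [h]
      · simp [Pi.single_eq_of_ne h]
    · rw [Finset.sum_eq_single (Fin.last N) (fun i _ hi => by simp [Pi.single_eq_of_ne hi])
        (by simp)]
      simp

lemma brunoTerm_single (F : ℝ → ℝ) (t : ℝ) (d : ℕ → ℝ) (N : ℕ) :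
    brunoTerm F t d (Pi.single (Fin.last N) 1 : Fin (N + 1) → ℕ) =
      iteratedDeriv 2 F t * d (N + 1) := by
  have h1 : ∀ g : Fin (N + 1) → ℝ, ∏ i, g i ^ (Pi.single (Fin.last N) 1 : Fin (N + 1) → ℕ) i =
      g (Fin.last N) := fun g => by
    rw [Finset.prod_eq_single (Fin.last N) (fun i _ hi => by simp [Pi.single_eq_of_ne hi])
      (by simp)]
    simp
  have h2 : ∏ i, (((Pi.single (Fin.last N) 1 : Fin (N + 1) → ℕ) i)! : ℝ) = 1 :=
    Finset.prod_eq_one fun i _ => by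
      by_cases h : i = Fin.last N
      · simp [h]
      · simp [Pi.single_eq_of_ne h]
  have h3 : ((N + 1)! : ℝ) ≠ 0 := by positivity
  rw [brunoTerm, brunoCoeff, h1 fun i => d ((i : ℕ) + 1), Finset.prod_mul_distrib, h2,
    h1 fun i => (((i : ℕ) + 1)! : ℝ)]
  simp [h3]

/-- The recursion for the derivatives of the optimal parameter at zero. -/
theorem derivAtZero_optimalParam (n : ℕ) (hn : 1 ≤ n) :
    derivAtZero optimalParam n =
      -(iteratedDeriv 2 (rllCondEntropy 0) (1 / Real.goldenRatio ^ 2))⁻¹ *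
        ((∑ k ∈ Finset.Icc 1 n, (n.choose k : ℝ) * (k ! : ℝ) *
            ∑ m ∈ bruno (n - k), brunoTerm (rllCondEntropy k) (1 / Real.goldenRatio ^ 2)
              (derivAtZero optimalParam) m) +
          ∑ m ∈ bruno n with ∀ i : Fin n, (i : ℕ) + 1 = n → m i = 0,
            brunoTerm (rllCondEntropy 0) (1 / Real.goldenRatio ^ 2)
              (derivAtZero optimalParam) m) := by
  obtain ⟨τ, hτ, hτ0, hcrit, heq⟩ := exists_analytic_optimalParam zero_mem_Ico
  rw [optimalParam_zero] at hτ0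
  have hI := inv_sq_goldenRatio_mem
  have hd : ∀ j, iteratedDeriv j τ 0 = derivAtZero optimalParam j := fun j =>
    (derivAtZero_eq heq hτ j).symm
  have hK : AnalyticAt ℝ (fun t => deriv entropySeq (τ t)) 0 := by
    refine AnalyticAt.fun_comp (g := deriv entropySeq) ?_ hτ
    rw [hτ0]
    exact (analyticOnNhd_entropySeq _ hI).deriv
  have hzero : (fun t => geomEval t (deriv entropySeq (τ t))) =ᶠ[𝓝 0] fun _ => 0 := by
    filter_upwards [hcrit] with t ht using ht.2
  have hterm : ∀ k j, iteratedDeriv j (fun t => deriv entropySeq (τ t) k) 0 =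
      ∑ m ∈ bruno j, brunoTerm (rllCondEntropy k) (1 / Real.goldenRatio ^ 2)
        (derivAtZero optimalParam) m := fun k j => by
    have hev : (fun t => deriv entropySeq (τ t) k) =ᶠ[𝓝 0]
        fun t => deriv (rllCondEntropy k) (τ t) := by
      filter_upwards [hcrit] with t ht using deriv_entropySeq_apply ht.1 k
    have han : AnalyticAt ℝ (deriv (rllCondEntropy k)) (τ 0) := by
      rw [hτ0]
      exact (analyticAt_rllCondEntropy hI k).deriv
    rw [hev.iteratedDeriv_eq, iteratedDeriv_comp_eq_sum_bruno hτ han]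
    refine Finset.sum_congr rfl fun m _ => ?_
    rw [brunoTerm, iteratedDeriv_succ', hτ0]
    simp only [hd]
  -- The critical equation holds identically along `τ`, so all its derivatives at `0` vanish; the
  -- summand `k = 0` contains the unknown.
  have hsum := iteratedDeriv_geomEval n hK
  rw [hzero.iteratedDeriv_eq] at hsum
  simp only [hterm, iteratedDeriv_fun_const_zero] at hsum
  rw [Finset.range_eq_Ico, Finset.sum_eq_sum_Ico_succ_bot (Nat.succ_pos n)] at hsum
  rw [show Finset.Ico (0 + 1) (n + 1) = Finset.Icc 1 n from rfl] at hsum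
  simp only [Nat.choose_zero_right, Nat.cast_one, Nat.factorial_zero, one_mul, Nat.sub_zero] at hsum
  obtain ⟨N, rfl⟩ : ∃ N, n = N + 1 := ⟨n - 1, by omega⟩
  rw [← Finset.sum_filter_add_sum_filter_not (bruno (N + 1))
    (fun m => ∀ i : Fin (N + 1), (i : ℕ) + 1 = N + 1 → m i = 0), bruno_filter_not,
    Finset.sum_singleton, brunoTerm_single] at hsum
  have hne := iteratedDeriv_two_rllCondEntropy_ne_zero
  rw [neg_mul, ← mul_neg, eq_inv_mul_iff_mul_eq₀ hne]
  linarith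

/-! #### The Taylor series of the capacity -/

/-- The coefficients of `(1 - ε) ^ 2 * ∑ ε ^ k * x k`. -/
def secondDifference (x : ℕ →ᵇ ℝ) : ℕ →ᵇ ℝ :=
  x - (2 : ℝ) • rightShift x + rightShift (rightShift x)

lemma geomEval_secondDifference {ε : ℝ} (hε : ε ∈ Metric.ball (0 : ℝ) 1) (x : ℕ →ᵇ ℝ) :
    geomEval ε (secondDifference x) = (1 - ε) ^ 2 * geomEval ε x := by
  simp only [secondDifference, map_add, map_sub, map_smul, geomEval_rightShift hε, smul_eq_mul]
  ring

lemma sum_range_eq_add_Icc_two (f : ℕ → ℝ) (n : ℕ) :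
    ∑ k ∈ Finset.range (n + 1), f k =
      f 0 + (if n = 0 then 0 else f 1) + ∑ k ∈ Finset.Icc 2 n, f k := by
  rw [Finset.range_eq_Ico, Finset.sum_eq_sum_Ico_succ_bot (Nat.succ_pos n)]
  rcases n with _ | n
  · simp
  · rw [Finset.sum_eq_sum_Ico_succ_bot (by omega), if_neg (Nat.succ_ne_zero n), ← add_assoc]
    rfl

/-- The three summands of `capacityCoeff` are the terms $k=0$, $k=1$ and $k\ge2$ of
`iteratedDeriv_geomEval`; the second difference looks different in the first two because
`rightShift` fills in zeros. -/
lemma capacityCoeff_eq {x : ℝ → ℕ →ᵇ ℝ} {G : ℕ → ℝ → ℝ} (hx : AnalyticAt ℝ x 0)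
    (hG : ∀ᶠ t in 𝓝[Ico 0 1] 0, ∀ k, G k t = x t k) (n : ℕ) :
    capacityCoeff G n = iteratedDeriv n (fun t => geomEval t (secondDifference (x t))) 0 := by
  have hS : AnalyticAt ℝ (fun t => secondDifference (x t)) 0 :=
    (hx.fun_sub (analyticAt_const.fun_smul ((rightShift.analyticAt _).comp hx))).fun_add
      ((rightShift.analyticAt _).comp ((rightShift.analyticAt _).comp hx))
  rw [iteratedDeriv_geomEval n hS, sum_range_eq_add_Icc_two, capacityCoeff]
  have hco : ∀ {g : ℝ → ℝ} (k : ℕ), (∀ᶠ t in 𝓝[Ico 0 1] 0, g t = secondDifference (x t) k) →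
      ∀ j, derivAtZero g j = iteratedDeriv j (fun t => secondDifference (x t) k) 0 :=
    fun k h j => derivAtZero_eq h (analyticAt_seq_apply hS k) j
  congr 1
  · congr 1
    · rw [hco 0 ?_]
      · simp
      · filter_upwards [hG] with t ht
        simp [secondDifference, ht]
    · rw [hco 1 ?_]
      · rcases n with _ | n <;> simp
      · filter_upwards [hG] with t ht
        simp [secondDifference, ht]
  · refine Finset.sum_congr rfl fun k hk => ?_
    obtain ⟨j, rfl⟩ : ∃ j, k = j + 2 := ⟨k - 2, by have := Finset.mem_Icc.1 hk; omega⟩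
    rw [hco (j + 2) ?_]
    filter_upwards [hG] with t ht
    simp [secondDifference, ht]
    ring

/-- The series is the Taylor series of a function analytic on both sides of $0$ that agrees with the
capacity on the right. -/
theorem hasSum_markovCapacity : ∃ r : ℝ, 0 < r ∧ ∀ ε ∈ Ico (0 : ℝ) r,
    HasSum (fun n : ℕ => capacityCoeff (entropyAlong optimalParam) n / (n ! : ℝ) * ε ^ n)
      (markovCapacity ε) := by
  obtain ⟨τ, hτ, hτ0, hcrit, heq⟩ := exists_analytic_optimalParam zero_mem_Ico
  have hx : AnalyticAt ℝ (fun t => entropySeq (τ t)) 0 :=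
    analyticAt_entropySeq_comp hτ (by rw [hτ0]; exact optimalParam_mem zero_mem_Ico)
  have hG : ∀ᶠ t in 𝓝[Ico 0 1] 0, ∀ k, entropyAlong optimalParam k t = entropySeq (τ t) k := by
    filter_upwards [heq, nhdsWithin_le_nhds hcrit] with t ht hc k
    rw [entropyAlong, ht, entropySeq_apply hc.1]
  have hS : AnalyticAt ℝ (fun t => (1 - t) ^ 2 * geomEval t (entropySeq (τ t))) 0 :=
    AnalyticAt.fun_mul (by fun_prop) (analyticAt_geomEval_apply zero_mem_unit_ball hx)
  have hev : (fun t => geomEval t (secondDifference (entropySeq (τ t)))) =ᶠ[𝓝 0]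
      fun t => (1 - t) ^ 2 * geomEval t (entropySeq (τ t)) := by
    filter_upwards [Metric.isOpen_ball.mem_nhds zero_mem_unit_ball] with t ht
      using geomEval_secondDifference ht _
  have hpow := (hasFPowerSeriesAt_iff.1 hS.hasFPowerSeriesAt)
  have hcap : ∀ᶠ t in 𝓝[Ico 0 1] 0,
      markovCapacity t = (1 - t) ^ 2 * geomEval t (entropySeq (τ t)) := by
    filter_upwards [heq, self_mem_nhdsWithin] with t ht hI
    rw [markovCapacity_eq_geomEval hI, ht]
  rw [nhdsWithin_Ico_eq_nhdsGE one_pos] at hcap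
  have hall := hcap.and (nhdsWithin_le_nhds hpow)
  obtain ⟨r, hr, hsub⟩ := mem_nhdsGE_iff_exists_Ico_subset.1 hall
  refine ⟨r, hr, fun ε hε => ?_⟩
  obtain ⟨h1, h2⟩ := hsub hε
  rw [h1]
  simp only [capacityCoeff_eq hx hG, hev.iteratedDeriv_eq]
  simpa [mul_comm] using h2

end BEC

end

/-! ### Assembly of the theorem -/

theorem mainTheorem3 :
    -- the mutual information rate of every admissible input exists as a limit
    (∀ ε ∈ Ico (0 : ℝ) 1, ∀ (π : BEC.Letter → ℝ) (P : Matrix BEC.Letter BEC.Letter ℝ),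
      BEC.IsStationaryChain π P → BEC.SupportedOn BEC.rllConstraint π P →
        Tendsto (BEC.blockInfo ε π P) atTop (𝓝 (BEC.infoRate ε π P))) ∧
    ∃ θmax : ℝ → ℝ,
      (∀ ε ∈ Ico (0 : ℝ) 1, BEC.IsOptimalParam ε (θmax ε)) ∧
      θmax 0 = 1 / Real.goldenRatio ^ 2 ∧
      -- a) analyticity of the optimal parameter and its derivatives at `0`
      AnalyticOn ℝ θmax (Ico 0 1) ∧
      (∀ n : ℕ, 1 ≤ n →
        BEC.derivAtZero θmax n =
          -(iteratedDeriv 2 (BEC.rllCondEntropy 0) (1 / Real.goldenRatio ^ 2))⁻¹ *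
            ((∑ k ∈ Finset.Icc 1 n, (n.choose k : ℝ) * (k ! : ℝ) *
                ∑ m ∈ BEC.bruno (n - k),
                  BEC.brunoTerm (BEC.rllCondEntropy k) (1 / Real.goldenRatio ^ 2) (BEC.derivAtZero θmax) m) +
              ∑ m ∈ BEC.bruno n with ∀ i : Fin n, (i : ℕ) + 1 = n → m i = 0,
                BEC.brunoTerm (BEC.rllCondEntropy 0) (1 / Real.goldenRatio ^ 2) (BEC.derivAtZero θmax) m)) ∧
      iteratedDeriv 2 (BEC.rllCondEntropy 0) (1 / Real.goldenRatio ^ 2) ≠ 0 ∧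
      -- b) analyticity of the capacity and its Taylor series at `0`
      (∀ ε ∈ Ico (0 : ℝ) 1,
        IsLUB (BEC.markovRates ε) (BEC.markovCapacity ε) ∧
        BEC.markovCapacity ε = BEC.rllRate ε (θmax ε)) ∧
      AnalyticOn ℝ BEC.markovCapacity (Ico 0 1) ∧
      (∀ k : ℕ, AnalyticOn ℝ (BEC.entropyAlong θmax k) (Ico 0 1)) ∧
      ∃ r : ℝ, 0 < r ∧ ∀ ε ∈ Ico (0 : ℝ) r,
        HasSum (fun n : ℕ => BEC.capacityCoeff (BEC.entropyAlong θmax) n / (n ! : ℝ) * ε ^ n)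
          (BEC.markovCapacity ε) :=
  ⟨fun _ hε _ _ h _ => by
    rw [BEC.infoRate_eq h hε]
    exact BEC.tendsto_blockInfo h hε,
  BEC.optimalParam, fun _ hε => BEC.isOptimalParam_optimalParam hε, BEC.optimalParam_zero,
  BEC.analyticOn_optimalParam, BEC.derivAtZero_optimalParam,
  BEC.iteratedDeriv_two_rllCondEntropy_ne_zero,
  fun _ hε => ⟨BEC.isLUB_markovCapacity hε, BEC.markovCapacity_eq hε⟩,
  BEC.analyticOn_markovCapacity, BEC.analyticOn_entropyAlong, BEC.hasSum_markovCapacity⟩
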